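/- **Setting.** Let $\ell,m\in\mathbb N$, let $a:\mathbb R^\ell\times\mathbb R^m\to\mathbb R^\ell$ be continuous, and let $N=\{N(t)\}_{t\ge 0}$ be an i.i.d. sequence of $\mathbb R^m$-valued random variables on a probability space. For $x\in\mathbb R^\ell$ let $X(0)=x$ and $X(t+1)=a(X(t),N(t+1))$, and write $\mathsf E_x$ for the expectation with $X(0)=x$. Let $P^t(x,A)=\mathsf P\{X(t)\in A\mid X(0)=x\}$, $P^tf(x)=\int f(y)\,P^t(x,dy)$, $P=P^1$. The sensitivity process is $S_{i,j}(t)=\partial X_i(t)/\partial X_j(0)$; for $g:\mathbb R^\ell\to\mathbb R^\ell$ let $Q^tg(x)=\mathsf E_x[S(t)^{\top}g(X(t))]$, and for scalar $f$ let $Q^t_{i,j}f(x)=\mathsf E_x[(S(t)^{\top})_{i,j}f(X(t))]$ be its components, $1\le i,j\le\ell$. **Assumptions.** (A1) The process $N$ does not depend on the initial condition $x$; $a(\cdot,n)$ is $C^1$ for each $n$, and $\sup_{x,n}\|\nabla_x a(x,n)\|<\infty$. (A2) For some $t_0\ge 1$ there is a $C^1$ function $p\ge 0$ on $\mathbb R^\ell\times\mathbb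 R^\ell$ with $P^{t_0}(x,A)=\int_A p(x,y)\,dy$ for all $x$ and all Borel sets $A$. (A3) There is $x_0\in\mathbb R^\ell$ such that, for every $x$ and every open set $O\ni x_0$, $P^t(x,O)>0$ for all sufficiently large $t$. (A4) There are $C^1$ functions $V:\mathbb R^\ell\to(0,\infty)$ and $W:\mathbb R^\ell\to[1,\infty)$ with compact sublevel sets, a compact set $C$, and constants $\delta>0$, $b<\infty$, such that $Pe^V$ is finite and $\log(Pe^V)-V\le-\delta W+b\,\mathbf 1_C$ everywhere. **Spaces.** Let $v=e^V$ and $v^\eta=e^{\eta V}$. For a function $w:\mathbb R^\ell\to[1,\infty)$ let $\|f\|_w=\sup_x|f(x)|/w(x)$, and let $L_\infty^{w}$ be the space of measurable $f$ with $\|f\|_w<\infty$. Let $L_{w,0}$ be the space of continuous $f\in L_\infty^w$ with norm $\|f\|_{w,0}=\|f\|_w$. Let $L_{w,1}$ be the space of $C^1$ functions $f$ such that $f,\partial_1f,\dots,\partial_\ell f\in L_{w,0}$, with norm $\|f\|_{w,1}=\max\{\|f\|_w,\|\partial_1f\|_w,\dots,\|\partial_\ell f\|_w\}$. Let $\mathcal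 M_1^w$ be the space of signed measures $\nu$ with $\sup\{|\nu(h)|/\|h\|_w: h\in L^w_\infty,\ \|h\|_w\ne0\}<\infty$. A linear operator $T$ on $L_{w,k}$ has *finite rank* if, for some $n<\infty$, $Tf=\sum_{i,j=1}^n m_{ij}\,\nu_j(f)\,s_i$ with $s_i\in L_{w,k}$, $\nu_j\in\mathcal M_1^w$, $m_{ij}\in\mathbb R$. A linear operator $\widehat P:L_{w,k}\to L_{w,k}$ is *separable in $L_{w,k}$* if for every $\varepsilon>0$ there is a finite-rank linear operator $T$ on $L_{w,k}$ with $\sup\{\|(\widehat P-T)f\|_{w,k}/\|f\|_{w,k}: f\in L_{w,k},\ \|f\|_{w,k}\ne0\}\le\varepsilon$. **Theorem.** Suppose that (A1)–(A4) hold. Then: (i) There is an integer $t_1\ge1$ such that for all $t\ge t_1$ and all $\eta\in(0,1]$: (a) $P^t$ is a well-defined linear operator $L_{v^\eta,k}\to L_{v^\eta,k}$ for $k=0,1$; (b) $Q^t_{i,j}$ is a well-defined linear operator $L_{v^\eta,0}\to L_{v^\eta,0}$ for all $1\le i,j\le\ell$; (c) $\nabla P^tf=Q^t\nabla f$ for all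 $f\in L_{v^\eta,1}$; (d) $P^t$ is separable in $L_{v^\eta,k}$ for $k=0$ and $k=1$. (ii) If $\eta\in(0,1)$, then (a), (b) and (c) hold for all $t\ge1$. -/

import Mathlib

open MeasureTheory ProbabilityTheory Filter Topology
open scoped ENNReal

noncomputable section

namespace WeightedSobolev

/-! ### Weighted norms and spaces on `ℝ^ℓ` -/

/-- `ℝ^ℓ` with its Euclidean structure and Borel sigma-algebra. -/
abbrev Rn (l : ℕ) : Type := EuclideanSpace ℝ (Fin l)

variable {l m : ℕ}

/-- The `i`-th partial derivative `∂f/∂xᵢ` (used for differentiable `f`). -/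
def pd (i : Fin l) (f : Rn l → ℝ) : Rn l → ℝ :=
  fun x => fderiv ℝ f x (EuclideanSpace.single i 1)

/-- `‖f‖_v = sup_x |f x| / v x`, as an extended nonnegative real. -/
def vNorm (v f : Rn l → ℝ) : ℝ≥0∞ := ⨆ x, ENNReal.ofReal (|f x| / v x)

/-- Membership in the space `L_∞^v` of measurable functions with `‖f‖_v < ∞`. -/
def MemLv (v f : Rn l → ℝ) : Prop := Measurable f ∧ vNorm v f < ∞

/-- `‖f‖_{v,k}`: the maximum of `‖D^α f‖_v` over all iterated partial derivatives of order
at most `k`. -/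
def sobNorm (v : Rn l → ℝ) : ℕ → (Rn l → ℝ) → ℝ≥0∞
  | 0, f => vNorm v f
  | k + 1, f => max (vNorm v f) (⨆ i : Fin l, sobNorm v k (pd i f))

/-- Membership in `L_{v,k}`: all partial derivatives of `f` up to order `k` exist and are continuous
(that is, `f` is of class `C^k`), and all of them have finite `v`-norm. For `k = 0`: `f` is
continuous with `‖f‖_v < ∞`. -/
def MemSob (v : Rn l → ℝ) (k : ℕ) (f : Rn l → ℝ) : Prop :=
  ContDiff ℝ k f ∧ sobNorm v k f < ∞

/-- `T` restricts to a linear operator from `L_{v,k}` to itself. -/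
structure IsLinearOpOn (v : Rn l → ℝ) (k : ℕ) (T : (Rn l → ℝ) → (Rn l → ℝ)) : Prop where
  mapsTo : ∀ f, MemSob v k f → MemSob v k (T f)
  map_add : ∀ f g, MemSob v k f → MemSob v k g → T (f + g) = T f + T g
  map_smul : ∀ (c : ℝ) f, MemSob v k f → T (c • f) = c • T f

/-- The induced operator norm `sup { ‖T f‖_{v,k} / ‖f‖_{v,k} : f ∈ L_{v,k}, ‖f‖_{v,k} ≠ 0 }`. -/
def opNorm (v : Rn l → ℝ) (k : ℕ) (T : (Rn l → ℝ) → (Rn l → ℝ)) : ℝ≥0∞ :=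
  ⨆ (f : Rn l → ℝ) (_ : MemSob v k f) (_ : sobNorm v k f ≠ 0), sobNorm v k (T f) / sobNorm v k f

/-- `‖ν‖_v = sup { |ν(h)| / ‖h‖_v : h ∈ L_∞^v, ‖h‖_v ≠ 0 }` for a signed measure `ν`, where
`ν(h) = ∫ h dν`. -/
def measNorm (v : Rn l → ℝ) (ν : SignedMeasure (Rn l)) : ℝ≥0∞ :=
  ⨆ (h : Rn l → ℝ) (_ : MemLv v h) (_ : vNorm v h ≠ 0),
    ENNReal.ofReal |∫ᵛ y, h y ∂•ν| / vNorm v h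

/-- Membership in `M_1^v`: signed measures `ν` for which `ν(h)` exists for every `h ∈ L_∞^v`, and
with `‖ν‖_v < ∞`. -/
def MemMv (v : Rn l → ℝ) (ν : SignedMeasure (Rn l)) : Prop :=
  (∀ h, MemLv v h → VectorMeasure.Integrable ν h) ∧ measNorm v ν < ∞

/-- `T` has finite rank on `L_{v,k}`: `T = ∑_{i,j} m_{ij} s_i ⊗ ν_j` with `s_i ∈ L_{v,k}` and
`ν_j ∈ M_1^v`, where `(s ⊗ ν) f (x) = s(x) ν(f)`. -/
def IsFiniteRank (v : Rn l → ℝ) (k : ℕ) (T : (Rn l → ℝ) → (Rn l → ℝ)) : Prop :=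
  ∃ (n : ℕ) (s : Fin n → Rn l → ℝ) (ν : Fin n → SignedMeasure (Rn l))
    (M : Matrix (Fin n) (Fin n) ℝ),
    (∀ i, MemSob v k (s i)) ∧ (∀ j, MemMv v (ν j)) ∧
      ∀ f, MemSob v k f → ∀ x, T f x = ∑ i, ∑ j, M i j * (s i x * ∫ᵛ y, f y ∂•(ν j))

/-- `T` is separable in `L_{v,k}`: it is a linear operator on `L_{v,k}` that is approximated
arbitrarily well in the induced operator norm by finite-rank linear operators. -/
def IsSeparableOp (v : Rn l → ℝ) (k : ℕ) (T : (Rn l → ℝ) → (Rn l → ℝ)) : Prop :=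
  IsLinearOpOn v k T ∧
    ∀ ε : ℝ, 0 < ε → ∃ S : (Rn l → ℝ) → (Rn l → ℝ),
      IsLinearOpOn v k S ∧ IsFiniteRank v k S ∧
        opNorm v k (fun f => T f - S f) ≤ ENNReal.ofReal ε

/-! ### The nonlinear state space model -/

variable {Ω : Type*} [MeasurableSpace Ω]

/-- The state `X(t)` started from `X(0) = x` and driven by the noise `N`, which does not depend on
`x`: `X(t+1) = a(X(t), N(t+1))`. -/
def state (a : Rn l → Rn m → Rn l) (N : ℕ → Ω → Rn m) : ℕ → Rn l → Ω → Rn l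
  | 0, x, _ => x
  | t + 1, x, ω => a (state a N t x ω) (N (t + 1) ω)

/-- The law `P^t(x, ·)` of `X(t)` given `X(0) = x`. -/
def law (μ : Measure Ω) (a : Rn l → Rn m → Rn l) (N : ℕ → Ω → Rn m) (t : ℕ) (x : Rn l) :
    Measure (Rn l) :=
  μ.map (state a N t x)

/-- The semigroup on functions: `P^t f (x) = ∫ f(y) P^t(x, dy)`. -/
def P (μ : Measure Ω) (a : Rn l → Rn m → Rn l) (N : ℕ → Ω → Rn m) (t : ℕ)
    (f : Rn l → ℝ) : Rn l → ℝ :=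
  fun x => ∫ y, f y ∂(law μ a N t x)

/-- The sensitivity process: `S_{i,j}(t) = ∂X_i(t) / ∂X_j(0)`, at the initial condition `x`. -/
def sens (a : Rn l → Rn m → Rn l) (N : ℕ → Ω → Rn m) (t : ℕ) (x : Rn l) (ω : Ω) :
    Matrix (Fin l) (Fin l) ℝ :=
  Matrix.of fun i j => pd j (fun z => state a N t z ω i) x

/-- The semigroup on `ℝ^ℓ`-valued functions: `Q^t g (x) = E[Sᵀ(t) g(X(t)) | X(0) = x]`, the
expectation being taken in each coordinate. -/
def Q (μ : Measure Ω) (a : Rn l → Rn m → Rn l) (N : ℕ → Ω → Rn m) (t : ℕ)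
    (g : Rn l → Rn l) : Rn l → Rn l :=
  fun x => WithLp.toLp 2 fun i =>
    ∫ ω, ((sens a N t x ω).transpose.mulVec (g (state a N t x ω)).ofLp) i ∂μ

/-- The `(i,j)` component of `Q^t`, acting on scalar functions:
`Q^t_{i,j} f (x) = E[(Sᵀ(t))_{i,j} f(X(t)) | X(0) = x]`. -/
def Qij (μ : Measure Ω) (a : Rn l → Rn m → Rn l) (N : ℕ → Ω → Rn m) (t : ℕ) (i j : Fin l)
    (f : Rn l → ℝ) : Rn l → ℝ :=
  fun x => ∫ ω, (sens a N t x ω).transpose i j * f (state a N t x ω) ∂μ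

/-! ### Assumptions -/

/-- `N` is a sequence of independent and identically distributed random variables. -/
structure IsIID (μ : Measure Ω) (N : ℕ → Ω → Rn m) : Prop where
  meas : ∀ t, Measurable (N t)
  indep : iIndepFun N μ
  ident : ∀ t, IdentDistrib (N t) (N 0) μ μ

/-- `a` is continuously differentiable in its first variable, with derivative bounded uniformly
in both variables. (That the noise does not depend on the initial condition is part of the
construction of `state`.) -/
def A1 (a : Rn l → Rn m → Rn l) : Prop :=
  (∀ n, ContDiff ℝ 1 (fun x => a x n)) ∧
    ∃ K : ℝ, ∀ x n, ‖fderiv ℝ (fun z => a z n) x‖ ≤ K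

/-- For some `t₀ ≥ 1`, `P^{t₀}` has a density that is continuously differentiable on
`ℝ^ℓ × ℝ^ℓ`. -/
def A2 (μ : Measure Ω) (a : Rn l → Rn m → Rn l) (N : ℕ → Ω → Rn m) : Prop :=
  ∃ t₀ : ℕ, 1 ≤ t₀ ∧ ∃ p : Rn l × Rn l → ℝ, ContDiff ℝ 1 p ∧ (∀ z, 0 ≤ p z) ∧
    ∀ x (A : Set (Rn l)), MeasurableSet A →
      law μ a N t₀ x A = ∫⁻ y in A, ENNReal.ofReal (p (x, y))

/-- There is a state `x₀` every neighbourhood of which is reached with positive probability from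
every initial condition at all sufficiently large times. -/
def A3 (μ : Measure Ω) (a : Rn l → Rn m → Rn l) (N : ℕ → Ω → Rn m) : Prop :=
  ∃ x₀ : Rn l, ∀ x, ∀ O : Set (Rn l), IsOpen O → x₀ ∈ O → ∀ᶠ t in atTop, 0 < law μ a N t x O

/-- The drift condition (DV3) for the pair `V`, `W`: the function `P e^V` exists, and
`log (P e^V) - V ≤ -δ W + b 1_C` for some compact set `C` and constants `δ > 0` and `b`. -/
def DV3 (μ : Measure Ω) (a : Rn l → Rn m → Rn l) (N : ℕ → Ω → Rn m) (V W : Rn l → ℝ) : Prop :=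
  (∀ x, Integrable (fun y => Real.exp (V y)) (law μ a N 1 x)) ∧
    ∃ (C : Set (Rn l)) (δ b : ℝ), IsCompact C ∧ 0 < δ ∧
      ∀ x, Real.log (P μ a N 1 (fun y => Real.exp (V y)) x) - V x
        ≤ -δ * W x + b * C.indicator (fun _ => (1 : ℝ)) x

/-- (DV3) holds for `V : ℝ^ℓ → (0,∞)` and some `W : ℝ^ℓ → [1,∞)`, both continuously differentiable
with compact sublevel sets. -/
def A4 (μ : Measure Ω) (a : Rn l → Rn m → Rn l) (N : ℕ → Ω → Rn m) (V : Rn l → ℝ) : Prop :=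
  (∀ x, 0 < V x) ∧ ContDiff ℝ 1 V ∧ (∀ r : ℝ, IsCompact {x | V x ≤ r}) ∧
    ∃ W : Rn l → ℝ, (∀ x, 1 ≤ W x) ∧ ContDiff ℝ 1 W ∧ (∀ r : ℝ, IsCompact {x | W x ≤ r}) ∧
      DV3 μ a N V W

/-- The weight `v^η = e^{η V}`, where `v = e^V`. -/
def weight (V : Rn l → ℝ) (η : ℝ) : Rn l → ℝ := fun x => Real.exp (η * V x)

/-! ### The conclusions at a fixed time `t` and for a fixed weight `v` -/

/-- `P^t` is a linear operator from `L_{v,k}` to itself for `k = 0, 1`, all the integrals that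
define it being convergent. -/
def ConclA (μ : Measure Ω) (a : Rn l → Rn m → Rn l) (N : ℕ → Ω → Rn m) (t : ℕ)
    (v : Rn l → ℝ) : Prop :=
  ∀ k : ℕ, k ≤ 1 →
    (∀ f, MemSob v k f → ∀ x, Integrable f (law μ a N t x)) ∧ IsLinearOpOn v k (P μ a N t)

/-- Each `Q^t_{i,j}` is a linear operator from `L_{v,0}` to itself, all the integrals that
define it being convergent. -/
def ConclB (μ : Measure Ω) (a : Rn l → Rn m → Rn l) (N : ℕ → Ω → Rn m) (t : ℕ)
    (v : Rn l → ℝ) : Prop :=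
  ∀ i j : Fin l,
    (∀ f, MemSob v 0 f → ∀ x,
      Integrable (fun ω => (sens a N t x ω).transpose i j * f (state a N t x ω)) μ) ∧
    IsLinearOpOn v 0 (Qij μ a N t i j)

/-- `∇ P^t f = Q^t ∇ f` for all `f ∈ L_{v,1}`; in particular `P^t f` is differentiable. -/
def ConclC (μ : Measure Ω) (a : Rn l → Rn m → Rn l) (N : ℕ → Ω → Rn m) (t : ℕ)
    (v : Rn l → ℝ) : Prop :=
  ∀ f, MemSob v 1 f → ∀ x, HasGradientAt (P μ a N t f) (Q μ a N t (gradient f) x) x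

/-- `P^t` is separable in `L_{v,k}` for `k = 0, 1`. -/
def ConclD (μ : Measure Ω) (a : Rn l → Rn m → Rn l) (N : ℕ → Ω → Rn m) (t : ℕ)
    (v : Rn l → ℝ) : Prop :=
  ∀ k : ℕ, k ≤ 1 → IsSeparableOp v k (P μ a N t)

end WeightedSobolev

end

open MeasureTheory ProbabilityTheory Filter Topology
open scoped ENNReal

noncomputable section

namespace WeightedSobolev

variable {l m : ℕ}

/-! ### Weighted norms as pointwise bounds -/

/-! Write `w = v^η`. The drift condition says `P v ≤ exp(V - δ W + |b|)`, and concavity of the power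
`η ≤ 1` turns this into `P w ≤ B u w` with `u = exp(-η δ W)`, which vanishes at infinity because `W`
has compact sublevel sets (`A4.exists_isDriftWeight`). Iterating, `P^t w ≤ B^t u w` for `t ≥ 1`: one
step of the chain gains decay relative to the weight.

The sensitivity process is bounded by the deterministic constant `K^t`, so `Q^t` is controlled by
`P^t`. What remains for (a), (b) and (c) is to pass limits through expectations of functions
dominated by `w(X(t))`. The majorant moves with the initial condition, and dominated convergence
with moving majorants needs exactly that `P^t w` is finite and continuous. This is `IsFellerWeight`.
The gradient formula then follows by writing increments of `P^t f` as integrals of the continuous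
field `Q^t ∇f` along segments (`IsFellerWeight.P_add_sub_P`, `IsFellerWeight.hasGradientAt_P`).

Continuity of `P^t w` has two sources. If `η < 1`, then `v^η` is negligible against `v` at infinity,
hence a limit in the `v`-norm of compactly supported continuous functions, and the ordinary Feller
property suffices at every time. If `η = 1` is allowed, write `P^{t₀+s} w = P^{t₀}(P^s w)` with `s ≥
1`: the inner function is negligible against `w`, and the density of `P^{t₀}` makes its truncations
continuous (`IsDriftWeight.isFellerWeight`).

For separability (`IsDriftWeight.conclD`), let `χ` be a cutoff of a large ball and split `P^{t₀+s} f
= (1-χ) P^{t₀+s} f + χ P^{t₀}((1-χ) P^s f) + χ P^{t₀}(χ P^s f)`. The first two terms are small by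
the decay of `u`, derivatives included. The third has a `C¹` kernel on a compact set, and
discretizing its second variable gives a finite-rank operator. -/

theorem vNorm_le_ofReal_iff {w f : Rn l → ℝ} (hw : ∀ x, 0 < w x) {c : ℝ} (hc : 0 ≤ c) :
    vNorm w f ≤ ENNReal.ofReal c ↔ ∀ x, |f x| ≤ c * w x := by
  simp only [vNorm, iSup_le_iff, ENNReal.ofReal_le_ofReal_iff hc, div_le_iff₀ (hw _)]

/-- All partial derivatives of `f` of order at most `k ≤ 1` are bounded by `c * w`. -/
def SobBound (w : Rn l → ℝ) (k : ℕ) (c : ℝ) (f : Rn l → ℝ) : Prop :=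
  (∀ x, |f x| ≤ c * w x) ∧ (k = 1 → ∀ i x, |pd i f x| ≤ c * w x)

theorem sobNorm_le_ofReal_iff {w f : Rn l → ℝ} (hw : ∀ x, 0 < w x) {k : ℕ} (hk : k ≤ 1) {c : ℝ}
    (hc : 0 ≤ c) : sobNorm w k f ≤ ENNReal.ofReal c ↔ SobBound w k c f := by
  interval_cases k
  · simp [sobNorm, SobBound, vNorm_le_ofReal_iff hw hc]
  · simp [sobNorm, SobBound, vNorm_le_ofReal_iff hw hc]

theorem memSob_iff {w f : Rn l → ℝ} (hw : ∀ x, 0 < w x) {k : ℕ} (hk : k ≤ 1) :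
    MemSob w k f ↔ ContDiff ℝ k f ∧ ∃ c, 0 ≤ c ∧ SobBound w k c f := by
  refine and_congr_right fun _ => ⟨fun h => ?_, fun ⟨c, hc, h⟩ => ?_⟩
  · refine ⟨(sobNorm w k f).toReal, ENNReal.toReal_nonneg, ?_⟩
    rw [← sobNorm_le_ofReal_iff hw hk ENNReal.toReal_nonneg, ENNReal.ofReal_toReal h.ne]
  · exact ((sobNorm_le_ofReal_iff hw hk hc).2 h).trans_lt ENNReal.ofReal_lt_top

/-- Testing with every real bound `c`, instead of the norm itself, keeps all later estimates in real
arithmetic; the bound is applied with `c` equal to the norm of `f`. -/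
theorem opNorm_le_ofReal {w : Rn l → ℝ} (hw : ∀ x, 0 < w x) {k : ℕ} (hk : k ≤ 1)
    {T : (Rn l → ℝ) → (Rn l → ℝ)} {ε : ℝ} (hε : 0 ≤ ε)
    (h : ∀ f c, 0 ≤ c → MemSob w k f → SobBound w k c f → SobBound w k (ε * c) (T f)) :
    opNorm w k T ≤ ENNReal.ofReal ε := by
  refine iSup_le fun f => iSup_le fun hf => iSup_le fun h0 => ?_
  refine ENNReal.div_le_of_le_mul ?_
  have hc : 0 ≤ (sobNorm w k f).toReal := ENNReal.toReal_nonneg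
  have key := h f _ hc hf ((sobNorm_le_ofReal_iff hw hk hc).1
    (by rw [ENNReal.ofReal_toReal hf.2.ne]))
  rw [← sobNorm_le_ofReal_iff hw hk (mul_nonneg hε hc), ENNReal.ofReal_mul hε,
    ENNReal.ofReal_toReal hf.2.ne] at key
  exact key

theorem contDiff_one_of_memSob {w f : Rn l → ℝ} (hf : MemSob w 1 f) : ContDiff ℝ 1 f := by
  simpa using hf.1

theorem MemSob.continuous {w f : Rn l → ℝ} {k : ℕ} (hf : MemSob w k f) : Continuous f :=
  hf.1.continuous

theorem continuous_pd {f : Rn l → ℝ} (hf : ContDiff ℝ 1 f) (i : Fin l) : Continuous (pd i f) :=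
  (hf.continuous_fderiv (by simp)).clm_apply continuous_const

theorem contDiff_of_le_one {f : Rn l → ℝ} (hf : ContDiff ℝ 1 f) {k : ℕ} (hk : k ≤ 1) :
    ContDiff ℝ k f := hf.of_le (by exact_mod_cast hk)

theorem abs_pd_le {f : Rn l → ℝ} (i : Fin l) (x : Rn l) : |pd i f x| ≤ ‖fderiv ℝ f x‖ := by
  simpa [pd] using (fderiv ℝ f x).le_opNorm (EuclideanSpace.single i 1)

theorem SobBound.of_hasCompactSupport {w f : Rn l → ℝ} (hw : ∀ x, 1 ≤ w x)
    (hf : ContDiff ℝ 1 f) (hs : HasCompactSupport f) :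
    ∃ c, 0 ≤ c ∧ ∀ k, SobBound w k c f := by
  obtain ⟨c₁, h₁⟩ := hs.exists_bound_of_continuous hf.continuous
  obtain ⟨c₂, h₂⟩ := (hs.fderiv (𝕜 := ℝ)).exists_bound_of_continuous (hf.continuous_fderiv (by simp))
  have h0 : 0 ≤ max 0 (max c₁ c₂) := le_max_left _ _
  refine ⟨_, h0, fun k => ⟨fun x => ?_, fun _ i x => ?_⟩⟩
  · calc |f x| ≤ c₁ := h₁ x
      _ ≤ max 0 (max c₁ c₂) := by simp
      _ ≤ _ := le_mul_of_one_le_right h0 (hw x)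
  · calc |pd i f x| ≤ c₂ := (abs_pd_le i x).trans (h₂ x)
      _ ≤ max 0 (max c₁ c₂) := by simp
      _ ≤ _ := le_mul_of_one_le_right h0 (hw x)

theorem MemSob.of_hasCompactSupport {w f : Rn l → ℝ} (hw : ∀ x, 1 ≤ w x)
    (hf : ContDiff ℝ 1 f) (hs : HasCompactSupport f) {k : ℕ} (hk : k ≤ 1) : MemSob w k f := by
  obtain ⟨c, hc, h⟩ := SobBound.of_hasCompactSupport hw hf hs
  exact (memSob_iff (fun x => one_pos.trans_le (hw x)) hk).2 ⟨contDiff_of_le_one hf hk, c, hc, h k⟩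

/-! ### Positive measures as signed measures -/

theorem integral_smul_toSignedMeasure {X : Type*} [MeasurableSpace X] (ν : Measure X)
    [IsFiniteMeasure ν] (f : X → ℝ) : ∫ᵛ y, f y ∂•ν.toSignedMeasure = ∫ y, f y ∂ν := by
  rw [← VectorMeasure.integral_toSignedMeasure]
  congr 1
  ext
  simp

/-- Since `|h| ≤ ‖h‖_w w` pointwise, the norm of the measure is at most `∫ w dν`. -/
theorem memMv_toSignedMeasure {w : Rn l → ℝ} (hw : ∀ x, 0 < w x) (ν : Measure (Rn l))
    [IsFiniteMeasure ν] (hν : Integrable w ν) : MemMv w ν.toSignedMeasure := by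
  have hb : ∀ h, MemLv w h → ∀ x, |h x| ≤ (vNorm w h).toReal * w x := fun h hh => by
    rw [← vNorm_le_ofReal_iff hw ENNReal.toReal_nonneg, ENNReal.ofReal_toReal hh.2.ne]
  have hi : ∀ h, MemLv w h → Integrable h ν := fun h hh =>
    (hν.const_mul (vNorm w h).toReal).mono' hh.1.aestronglyMeasurable
      (Eventually.of_forall fun x => hb h hh x)
  refine ⟨fun h hh => ?_, ?_⟩
  · rw [VectorMeasure.Integrable, Measure.variation_toSignedMeasure]
    exact hi h hh
  · refine lt_of_le_of_lt (b := ENNReal.ofReal (∫ y, w y ∂ν)) ?_ ENNReal.ofReal_lt_top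
    refine iSup_le fun h => iSup_le fun hh => iSup_le fun h0 => ?_
    refine ENNReal.div_le_of_le_mul ?_
    rw [integral_smul_toSignedMeasure]
    calc ENNReal.ofReal |∫ y, h y ∂ν|
        ≤ ENNReal.ofReal (∫ y, (vNorm w h).toReal * w y ∂ν) := by
          refine ENNReal.ofReal_le_ofReal (abs_integral_le_integral_abs.trans ?_)
          exact integral_mono (hi h hh).abs (hν.const_mul _) (hb h hh)
      _ = _ := by
          rw [integral_const_mul, mul_comm,
            ENNReal.ofReal_mul (integral_nonneg fun x => (hw x).le), ENNReal.ofReal_toReal hh.2.ne]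

/-! ### Regularity of the state in the initial condition -/

section Regularity

variable {Ω : Type*} {a : Rn l → Rn m → Rn l} {N : ℕ → Ω → Rn m}

theorem contDiff_state (ha : ∀ n, ContDiff ℝ 1 fun x => a x n) (t : ℕ) (ω : Ω) :
    ContDiff ℝ 1 fun x => state a N t x ω := by
  induction t with
  | zero => exact contDiff_id
  | succ t ih => exact (ha (N (t + 1) ω)).comp ih

theorem continuous_state (ha : ∀ n, ContDiff ℝ 1 fun x => a x n) (t : ℕ) (ω : Ω) :
    Continuous fun x => state a N t x ω := (contDiff_state ha t ω).continuous

theorem differentiable_state (ha : ∀ n, ContDiff ℝ 1 fun x => a x n) (t : ℕ) (ω : Ω) :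
    Differentiable ℝ fun x => state a N t x ω := (contDiff_state ha t ω).differentiable (by simp)

/-- By the chain rule the derivative of the state is a product of `t` Jacobians of `a`. The
resulting bound depends neither on `x` nor on the noise, so the sensitivity process never affects
integrability. -/
theorem norm_fderiv_state_le (ha : ∀ n, ContDiff ℝ 1 fun x => a x n) {K : ℝ} (hK0 : 0 ≤ K)
    (hK : ∀ x n, ‖fderiv ℝ (fun z => a z n) x‖ ≤ K) (t : ℕ) (ω : Ω) (x : Rn l) :
    ‖fderiv ℝ (fun z => state a N t z ω) x‖ ≤ K ^ t := by
  induction t with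
  | zero => simpa [state] using ContinuousLinearMap.norm_id_le
  | succ t ih =>
    have h : fderiv ℝ (fun z => state a N (t + 1) z ω) x =
        (fderiv ℝ (fun z => a z (N (t + 1) ω)) (state a N t x ω)).comp
          (fderiv ℝ (fun z => state a N t z ω) x) :=
      fderiv_comp (g := fun z => a z (N (t + 1) ω)) x
        ((ha _).differentiable (by simp) _) (differentiable_state ha t ω x)
    rw [h, pow_succ']
    exact (ContinuousLinearMap.opNorm_comp_le _ _).trans
      (mul_le_mul (hK _ _) ih (norm_nonneg _) hK0)

theorem sens_apply (ha : ∀ n, ContDiff ℝ 1 fun x => a x n) (t : ℕ) (x : Rn l) (ω : Ω)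
    (i j : Fin l) :
    sens a N t x ω i j = fderiv ℝ (fun z => state a N t z ω) x (EuclideanSpace.single j 1) i := by
  have h := ((EuclideanSpace.proj i : Rn l →L[ℝ] ℝ).hasFDerivAt.comp x
    (differentiable_state (N := N) ha t ω x).hasFDerivAt).fderiv
  exact DFunLike.congr_fun h (EuclideanSpace.single j 1)

theorem abs_sens_le (ha : ∀ n, ContDiff ℝ 1 fun x => a x n) {K : ℝ} (hK0 : 0 ≤ K)
    (hK : ∀ x n, ‖fderiv ℝ (fun z => a z n) x‖ ≤ K) (t : ℕ) (ω : Ω) (x : Rn l) (i j : Fin l) :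
    |sens a N t x ω i j| ≤ K ^ t := by
  rw [sens_apply ha]
  calc _ ≤ ‖fderiv ℝ (fun z => state a N t z ω) x (EuclideanSpace.single j 1)‖ :=
        PiLp.norm_apply_le _ i
    _ ≤ ‖fderiv ℝ (fun z => state a N t z ω) x‖ * ‖EuclideanSpace.single j (1 : ℝ)‖ :=
        ContinuousLinearMap.le_opNorm _ _
    _ ≤ K ^ t := by simpa using norm_fderiv_state_le ha hK0 hK t ω x

theorem continuous_sens (ha : ∀ n, ContDiff ℝ 1 fun x => a x n) (t : ℕ) (ω : Ω) (i j : Fin l) :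
    Continuous fun x => sens a N t x ω i j := by
  simp only [sens_apply ha]
  have h := ((contDiff_state (N := N) ha t ω).continuous_fderiv (by simp)).clm_apply
    (continuous_const (y := EuclideanSpace.single j (1 : ℝ)))
  exact (EuclideanSpace.proj i : Rn l →L[ℝ] ℝ).continuous.comp h

/-- The chain rule for `f (X(t))`, in terms of the sensitivity process. -/
theorem hasFDerivAt_comp_state (ha : ∀ n, ContDiff ℝ 1 fun x => a x n) {f : Rn l → ℝ}
    (hf : ContDiff ℝ 1 f) (t : ℕ) (ω : Ω) (x : Rn l) :
    ∃ L : Rn l →L[ℝ] ℝ, HasFDerivAt (fun z => f (state a N t z ω)) L x ∧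
      ∀ h : Rn l, L h = ∑ i, h i * ∑ j, sens a N t x ω j i * pd j f (state a N t x ω) := by
  refine ⟨_, (hf.differentiable (by simp) _).hasFDerivAt.comp x
    (differentiable_state ha t ω x).hasFDerivAt, fun h => ?_⟩
  -- Expansion in the standard basis, stated for a general target because it is used for both
  -- factors of the chain rule: the derivative of the state and the derivative of `f`.
  have key : ∀ (E : Type _) [AddCommGroup E] [Module ℝ E] (T : Rn l →ₗ[ℝ] E) (y : Rn l),
      T y = ∑ i, y i • T (EuclideanSpace.single i 1) := fun E _ _ T y => by
    conv_lhs => rw [← (EuclideanSpace.basisFun (Fin l) ℝ).sum_repr y]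
    simp
  have h1 := key _ (fderiv ℝ (fun z => state a N t z ω) x : Rn l →ₗ[ℝ] Rn l) h
  rw [ContinuousLinearMap.comp_apply]
  simp only [ContinuousLinearMap.coe_coe] at h1
  rw [h1, map_sum]
  refine Finset.sum_congr rfl fun i _ => ?_
  rw [map_smul, smul_eq_mul]
  congr 1
  have h2 := key _ (fderiv ℝ f (state a N t x ω) : Rn l →ₗ[ℝ] ℝ)
    (fderiv ℝ (fun z => state a N t z ω) x (EuclideanSpace.single i 1))
  simp only [ContinuousLinearMap.coe_coe] at h2
  rw [h2]
  exact Finset.sum_congr rfl fun j _ => by rw [sens_apply ha, smul_eq_mul, pd]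

variable [MeasurableSpace Ω]

theorem measurable_state_uncurry (ha : Continuous fun z : Rn l × Rn m => a z.1 z.2)
    (hN : ∀ t, Measurable (N t)) (t : ℕ) :
    Measurable fun z : Rn l × Ω => state a N t z.1 z.2 := by
  induction t with
  | zero => exact measurable_fst
  | succ t ih => exact ha.measurable.comp (ih.prodMk ((hN (t + 1)).comp measurable_snd))

theorem measurable_state (ha : Continuous fun z : Rn l × Rn m => a z.1 z.2)
    (hN : ∀ t, Measurable (N t)) (t : ℕ) (x : Rn l) : Measurable (state a N t x) :=
  (measurable_state_uncurry ha hN t).comp measurable_prodMk_left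

theorem measurable_sens_uncurry (ha' : Continuous fun z : Rn l × Rn m => a z.1 z.2)
    (ha : ∀ n, ContDiff ℝ 1 fun x => a x n) (hN : ∀ t, Measurable (N t)) (t : ℕ) (i j : Fin l) :
    Measurable fun z : Rn l × Ω => sens a N t z.1 z.2 i j := by
  simp only [sens_apply ha]
  have hm : Measurable fun z : Rn l × Ω =>
      fderiv ℝ (fun y => state a N t y z.2) z.1 (EuclideanSpace.single j 1) := by
    -- Joint measurability in the initial condition and the noise: a partial derivative is the limit
    -- of difference quotients with step `1/n`, each of which is jointly measurable.
    have hlim : ∀ z : Rn l × Ω, Tendsto (fun n : ℕ => (n : ℝ) •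
        (state a N t (z.1 + (n : ℝ)⁻¹ • EuclideanSpace.single j 1) z.2 - state a N t z.1 z.2)) atTop
        (𝓝 (fderiv ℝ (fun y => state a N t y z.2) z.1 (EuclideanSpace.single j 1))) := fun z => by
      refine (differentiable_state (N := N) ha t z.2 z.1).hasFDerivAt.lim
        (EuclideanSpace.single j 1) ?_
      simpa using tendsto_natCast_atTop_atTop (R := ℝ)
    refine measurable_of_tendsto_metrizable (fun n => ?_) (tendsto_pi_nhds.2 hlim)
    have h := measurable_state_uncurry ha' hN t
    have h' : Measurable fun z : Rn l × Ω =>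
        state a N t (z.1 + (n : ℝ)⁻¹ • EuclideanSpace.single j 1) z.2 :=
      h.comp ((measurable_fst.add_const _).prodMk measurable_snd)
    exact (h'.sub h).const_smul (n : ℝ)
  exact (EuclideanSpace.proj i : Rn l →L[ℝ] ℝ).continuous.measurable.comp hm

end Regularity

/-! ### The Markov property -/

section Markov

variable {Ω : Type*} [MeasurableSpace Ω] {μ : Measure Ω} {a : Rn l → Rn m → Rn l} {N : ℕ → Ω → Rn m}

/-- The state at time `t` is measurable with respect to the noise up to time `t`, whose
sigma-algebra is independent of the next noise variable. -/
theorem indepFun_state (ha : Continuous fun z : Rn l × Rn m => a z.1 z.2) (hN : IsIID μ N)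
    (t : ℕ) (x : Rn l) : IndepFun (state a N t x) (N (t + 1)) μ := by
  have h := indep_iSup_of_disjoint (fun i => (hN.meas i).comap_le) hN.indep.iIndep
    (S := Set.Iic t) (T := {t + 1}) (by simp)
  rw [iSup_singleton] at h
  rw [IndepFun_iff_Indep]
  refine indep_of_indep_of_le_left h ?_
  rw [← measurable_iff_comap_le]
  have key : ∀ s ≤ t, Measurable[⨆ i ∈ Set.Iic t, MeasurableSpace.comap (N i) inferInstance]
      (state a N s x) := by
    intro s
    induction s with
    | zero => intro _; exact measurable_const
    | succ s ih =>
      intro hs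
      refine ha.measurable.comp (Measurable.prodMk (ih (by omega)) ?_)
      rw [measurable_iff_comap_le]
      exact le_iSup₂_of_le (s + 1) hs le_rfl
  exact key t le_rfl

/-- Identical distribution allows the one-step law to be driven by the noise at any time; `law_succ`
needs it at time `t + 1`. -/
theorem law_one (hN : IsIID μ N) (ha : Continuous fun z : Rn l × Rn m => a z.1 z.2) (t : ℕ)
    (x : Rn l) : law μ a N 1 x = μ.map fun ω => a x (N t ω) := by
  have h : ∀ s, μ.map (fun ω => a x (N s ω)) = (μ.map (N 0)).map (a x) := fun s => by
    rw [← (hN.ident s).map_eq, Measure.map_map (by fun_prop) (hN.meas s)]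
    rfl
  rw [h t, ← h 1]
  rfl

theorem P_eq_integral (ha : Continuous fun z : Rn l × Rn m => a z.1 z.2)
    (hN : ∀ t, Measurable (N t)) (t : ℕ) {f : Rn l → ℝ} (hf : Measurable f) (x : Rn l) :
    P μ a N t f x = ∫ ω, f (state a N t x ω) ∂μ :=
  integral_map (measurable_state ha hN t x).aemeasurable hf.aestronglyMeasurable

theorem integrable_law_iff (ha : Continuous fun z : Rn l × Rn m => a z.1 z.2)
    (hN : ∀ t, Measurable (N t)) (t : ℕ) {f : Rn l → ℝ} (hf : Measurable f) (x : Rn l) :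
    Integrable f (law μ a N t x) ↔ Integrable (fun ω => f (state a N t x ω)) μ :=
  integrable_map_measure hf.aestronglyMeasurable (measurable_state ha hN t x).aemeasurable

variable [IsProbabilityMeasure μ]

theorem law_zero (x : Rn l) : law μ a N 0 x = Measure.dirac x := by
  change μ.map (fun _ => x) = _
  simp

theorem isProbabilityMeasure_law (ha : Continuous fun z : Rn l × Rn m => a z.1 z.2)
    (hN : ∀ t, Measurable (N t)) (t : ℕ) (x : Rn l) : IsProbabilityMeasure (law μ a N t x) :=
  Measure.isProbabilityMeasure_map (measurable_state ha hN t x).aemeasurable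

theorem measurable_law (ha : Continuous fun z : Rn l × Rn m => a z.1 z.2)
    (hN : ∀ t, Measurable (N t)) (t : ℕ) : Measurable (law μ a N t) := by
  refine Measure.measurable_of_measurable_coe _ fun s hs => ?_
  have h := measurable_measure_prodMk_left (ν := μ) (measurable_state_uncurry ha hN t hs)
  convert h using 2 with x
  rw [law, Measure.map_apply (measurable_state ha hN t x) hs]
  rfl

/-- The transition kernel `P^t`. -/
def lawKernel (μ : Measure Ω) (ha : Continuous fun z : Rn l × Rn m => a z.1 z.2)
    [IsProbabilityMeasure μ] (hN : ∀ t, Measurable (N t)) (t : ℕ) : Kernel (Rn l) (Rn l) :=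
  ⟨law μ a N t, measurable_law ha hN t⟩

/-- The Markov property: by independence the joint law of `X(t)` and `N(t+1)` is a product measure,
and integrating out the noise first leaves the one-step law started at `X(t)`. -/
theorem law_succ (ha : Continuous fun z : Rn l × Rn m => a z.1 z.2) (hN : IsIID μ N) (t : ℕ)
    (x : Rn l) : law μ a N (t + 1) x = (law μ a N t x).bind (law μ a N 1) := by
  ext s hs
  have hst := measurable_state ha hN.meas t x
  rw [Measure.bind_apply hs (measurable_law ha hN.meas 1).aemeasurable]
  have hprod := (indepFun_iff_map_prod_eq_prod_map_map hst.aemeasurable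
    (hN.meas (t + 1)).aemeasurable).1 (indepFun_state ha hN t x)
  have h1 : law μ a N (t + 1) x
      = ((law μ a N t x).prod (μ.map (N (t + 1)))).map fun z => a z.1 z.2 := by
    rw [law, law, ← hprod, Measure.map_map ha.measurable (hst.prodMk (hN.meas _))]
    rfl
  have := isProbabilityMeasure_law (μ := μ) ha hN.meas t x
  have := Measure.isProbabilityMeasure_map (μ := μ) (hN.meas (t + 1)).aemeasurable
  rw [h1, Measure.map_apply ha.measurable hs, Measure.prod_apply (ha.measurable hs)]
  refine lintegral_congr fun y => ?_
  have hy : Measurable (a y) := by fun_prop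
  have hy' : Measurable fun ω => a y (N (t + 1) ω) := hy.comp (hN.meas _)
  rw [law_one hN ha (t + 1) y, Measure.map_apply hy' hs,
    Measure.map_apply (hN.meas _) (measurable_prodMk_left (ha.measurable hs))]
  rfl

theorem law_add (ha : Continuous fun z : Rn l × Rn m => a z.1 z.2) (hN : IsIID μ N) (t s : ℕ)
    (x : Rn l) : law μ a N (t + s) x = (law μ a N t x).bind (law μ a N s) := by
  have hm := fun s => (measurable_law (μ := μ) ha hN.meas s)
  induction s with
  | zero =>
    have : law μ a N 0 = Measure.dirac := funext law_zero
    rw [this, Measure.bind_dirac, add_zero]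
  | succ s ih =>
    rw [← add_assoc, law_succ ha hN, ih,
      Measure.bind_bind (hm s).aemeasurable (hm 1).aemeasurable]
    congr 1
    ext1 y
    exact (law_succ ha hN s y).symm

theorem lintegral_law_add (ha : Continuous fun z : Rn l × Rn m => a z.1 z.2) (hN : IsIID μ N)
    (t s : ℕ) (x : Rn l) {f : Rn l → ℝ≥0∞} (hf : Measurable f) :
    ∫⁻ y, f y ∂(law μ a N (t + s) x) = ∫⁻ y, ∫⁻ z, f z ∂(law μ a N s y) ∂(law μ a N t x) := by
  rw [law_add ha hN, Measure.lintegral_bind (measurable_law ha hN.meas s).aemeasurable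
    hf.aemeasurable]

theorem P_add (ha : Continuous fun z : Rn l × Rn m => a z.1 z.2) (hN : IsIID μ N)
    (t s : ℕ) (x : Rn l) {f : Rn l → ℝ} (hf : Integrable f (law μ a N (t + s) x)) :
    P μ a N (t + s) f x = P μ a N t (P μ a N s f) x := by
  unfold P
  rw [law_add ha hN] at hf ⊢
  exact ProbabilityTheory.Kernel.integral_comp (κ := lawKernel μ ha hN.meas t)
    (η := lawKernel μ ha hN.meas s) (a := x) hf

theorem measurable_P (ha : Continuous fun z : Rn l × Rn m => a z.1 z.2)
    (hN : ∀ t, Measurable (N t)) (t : ℕ) {f : Rn l → ℝ} (hf : Measurable f) :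
    Measurable (P μ a N t f) := by
  have : IsMarkovKernel (lawKernel μ ha hN t) := ⟨fun x => isProbabilityMeasure_law ha hN t x⟩
  exact (hf.stronglyMeasurable.integral_kernel (κ := lawKernel μ ha hN t)).measurable

end Markov

variable {Ω : Type*} [MeasurableSpace Ω]

/-! ### Dominated convergence with a convergent sequence of bounds -/

/-- If `|F i| ≤ G i`, `F i → f` and `G i → g` pointwise and `∫ G i → ∫ g`, then `∫ F i → ∫ f`. -/
theorem tendsto_integral_of_abs_le_of_tendsto_integral {μ : Measure Ω} {ι : Type*} {𝓕 : Filter ι}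
    [𝓕.IsCountablyGenerated] {F G : ι → Ω → ℝ} {f g : Ω → ℝ}
    (hF : ∀ i, Measurable (F i)) (hG : ∀ i, Integrable (G i) μ) (hGm : ∀ i, Measurable (G i))
    (hg : Integrable g μ) (hgm : Measurable g) (hFG : ∀ i ω, |F i ω| ≤ G i ω)
    (hfg : ∀ ω, |f ω| ≤ g ω)
    (hFf : ∀ ω, Tendsto (fun i => F i ω) 𝓕 (𝓝 (f ω)))
    (hGg : ∀ ω, Tendsto (fun i => G i ω) 𝓕 (𝓝 (g ω)))
    (hint : Tendsto (fun i => ∫ ω, G i ω ∂μ) 𝓕 (𝓝 (∫ ω, g ω ∂μ))) :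
    Tendsto (fun i => ∫ ω, F i ω ∂μ) 𝓕 (𝓝 (∫ ω, f ω ∂μ)) := by
  have hg0 : ∀ ω, 0 ≤ g ω := fun ω => (abs_nonneg _).trans (hfg ω)
  have hG0 : ∀ i ω, 0 ≤ G i ω := fun i ω => (abs_nonneg _).trans (hFG i ω)
  -- the positive part of `g - G i` and the truncation of `F i` at level `g` are dominated by `g`
  have h1 : Tendsto (fun i => ∫ ω, max (g ω - G i ω) 0 ∂μ) 𝓕 (𝓝 (∫ ω, (0 : ℝ) ∂μ)) := by
    refine tendsto_integral_filter_of_dominated_convergence g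
      (Eventually.of_forall fun i =>
        ((hgm.sub (hGm i)).max measurable_const).aestronglyMeasurable)
      (Eventually.of_forall fun i => Eventually.of_forall fun ω => ?_) hg
      (Eventually.of_forall fun ω => ?_)
    · rw [Real.norm_of_nonneg (le_max_right _ _)]
      exact max_le (by linarith [hG0 i ω]) (hg0 ω)
    · simpa using ((tendsto_const_nhds (x := g ω)).sub (hGg ω)).max
        (tendsto_const_nhds (x := (0 : ℝ)))
  have h2 : Tendsto (fun i => ∫ ω, max (-g ω) (min (F i ω) (g ω)) ∂μ) 𝓕 (𝓝 (∫ ω, f ω ∂μ)) := by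
    refine tendsto_integral_filter_of_dominated_convergence g
      (Eventually.of_forall fun i =>
        (hgm.neg.max ((hF i).min hgm)).aestronglyMeasurable)
      (Eventually.of_forall fun i => Eventually.of_forall fun ω => ?_) hg
      (Eventually.of_forall fun ω => ?_)
    · rw [Real.norm_eq_abs, abs_le]
      exact ⟨le_max_left _ _, max_le (by linarith [hg0 ω]) (min_le_right _ _)⟩
    · have h := (tendsto_const_nhds (x := -g ω)).max
        ((hFf ω).min (tendsto_const_nhds (x := g ω)))
      rwa [min_eq_left (abs_le.1 (hfg ω)).2, max_eq_right (abs_le.1 (hfg ω)).1] at h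
  have hFi : ∀ i, Integrable (F i) μ := fun i =>
    (hG i).mono' (hF i).aestronglyMeasurable (Eventually.of_forall (hFG i))
  have hpi : ∀ i, Integrable (fun ω => max (g ω - G i ω) 0) μ := fun i => (hg.sub (hG i)).pos_part
  have hti : ∀ i, Integrable (fun ω => max (-g ω) (min (F i ω) (g ω))) μ := fun i =>
    hg.neg.sup ((hFi i).inf hg)
  -- Truncation changes `F i` by at most the positive part of `G i - g`, which equals `(G i - g) +
  -- max (g - G i) 0`. The integrals of both summands tend to `0`.
  have h3 : Tendsto (fun i => ∫ ω, F i ω ∂μ - ∫ ω, max (-g ω) (min (F i ω) (g ω)) ∂μ) 𝓕 (𝓝 0) := by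
    have h4 := (hint.sub_const (∫ ω, g ω ∂μ)).add h1
    simp only [sub_self, integral_zero, add_zero] at h4
    refine squeeze_zero_norm (fun i => ?_) h4
    have h5 : Integrable (fun ω => G i ω - g ω) μ := (hG i).sub hg
    rw [← integral_sub (hFi i) (hti i), ← integral_sub (hG i) hg, ← integral_add h5 (hpi i)]
    refine norm_integral_le_of_norm_le (((hG i).sub hg).add (hpi i))
      (Eventually.of_forall fun ω => ?_)
    have := abs_le.1 (hFG i ω)
    have := hg0 ω
    rw [Real.norm_eq_abs, abs_le]
    rcases max_cases (g ω - G i ω) 0 with h | h <;>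
      rcases min_cases (F i ω) (g ω) with h' | h' <;>
      rcases max_cases (-g ω) (min (F i ω) (g ω)) with h'' | h'' <;>
      constructor <;> linarith
  simpa using h3.add h2

/-! ### The semigroups on functions dominated by a weight with continuous expectation -/

/-- The standing assumptions on the model, with the bound `K` on the derivative of `a`. -/
structure IsSmoothModel (μ : Measure Ω) (a : Rn l → Rn m → Rn l) (N : ℕ → Ω → Rn m) (K : ℝ) :
    Prop where
  continuous : Continuous fun z : Rn l × Rn m => a z.1 z.2
  iid : IsIID μ N
  contDiff : ∀ n, ContDiff ℝ 1 fun x => a x n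
  nonneg : 0 ≤ K
  norm_fderiv_le : ∀ x n, ‖fderiv ℝ (fun z => a z n) x‖ ≤ K

/-- A continuous weight `w` for which `P^t w` is finite and continuous. -/
structure IsFellerWeight (μ : Measure Ω) (a : Rn l → Rn m → Rn l) (N : ℕ → Ω → Rn m) (t : ℕ)
    (w : Rn l → ℝ) : Prop where
  continuous : Continuous w
  integrable : ∀ x, Integrable w (law μ a N t x)
  continuous_P : Continuous (P μ a N t w)

section Core

variable {μ : Measure Ω} {a : Rn l → Rn m → Rn l} {N : ℕ → Ω → Rn m}
  {K : ℝ} {t : ℕ} {w : Rn l → ℝ}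

theorem IsFellerWeight.integrable_of_abs_le (hM : IsSmoothModel μ a N K)
    (hw : IsFellerWeight μ a N t w) {x : Rn l} {Z : Ω → ℝ} (hZ : Measurable Z) {c : ℝ}
    (hc : ∀ ω, |Z ω| ≤ c * w (state a N t x ω)) : Integrable Z μ :=
  (((integrable_law_iff hM.continuous hM.iid.meas t hw.continuous.measurable x).1
    (hw.integrable x)).const_mul c).mono' hZ.aestronglyMeasurable (Eventually.of_forall hc)

theorem IsFellerWeight.abs_integral_le (hM : IsSmoothModel μ a N K)
    (hw : IsFellerWeight μ a N t w) {x : Rn l} {Z : Ω → ℝ} {c : ℝ}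
    (hc : ∀ ω, |Z ω| ≤ c * w (state a N t x ω)) : |∫ ω, Z ω ∂μ| ≤ c * P μ a N t w x := by
  rw [P_eq_integral hM.continuous hM.iid.meas t hw.continuous.measurable, ← integral_const_mul]
  exact norm_integral_le_of_norm_le (f := Z)
    (((integrable_law_iff hM.continuous hM.iid.meas t hw.continuous.measurable x).1
      (hw.integrable x)).const_mul c) (Eventually.of_forall hc)

/-- The majorant `c w(X(t))` varies with `x`, and no integrable function is assumed to dominate it
near a given point. Continuity of `P^t w` makes the integrals of the majorants converge, which is
enough for dominated convergence with moving bounds. -/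
theorem IsFellerWeight.continuous_integral (hM : IsSmoothModel μ a N K)
    (hw : IsFellerWeight μ a N t w) {Z : Rn l → Ω → ℝ} (hZ : ∀ x, Measurable (Z x))
    (hZc : ∀ ω, Continuous fun x => Z x ω) {c : ℝ}
    (hc : ∀ x ω, |Z x ω| ≤ c * w (state a N t x ω)) : Continuous fun x => ∫ ω, Z x ω ∂μ := by
  have hmeas : ∀ x, Measurable fun ω => c * w (state a N t x ω) := fun x =>
    (hw.continuous.measurable.comp (measurable_state hM.continuous hM.iid.meas t x)).const_mul c
  have hint : ∀ x, Integrable (fun ω => c * w (state a N t x ω)) μ := fun x =>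
    ((integrable_law_iff hM.continuous hM.iid.meas t hw.continuous.measurable x).1
      (hw.integrable x)).const_mul c
  have hcont : ∀ ω, Continuous fun x => c * w (state a N t x ω) := fun ω =>
    continuous_const.mul (hw.continuous.comp (continuous_state hM.contDiff t ω))
  refine continuous_iff_continuousAt.2 fun x => ?_
  refine tendsto_integral_of_abs_le_of_tendsto_integral hZ hint hmeas (hint x) (hmeas x) hc (hc x)
    (fun ω => (hZc ω).tendsto x) (fun ω => (hcont ω).tendsto x) ?_
  simp_rw [integral_const_mul, ← P_eq_integral hM.continuous hM.iid.meas t hw.continuous.measurable]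
  exact (continuous_const.mul hw.continuous_P).tendsto x

theorem IsFellerWeight.integrable_law (hw : IsFellerWeight μ a N t w) {f : Rn l → ℝ}
    (hf : Measurable f) {c : ℝ} (hc : ∀ x, |f x| ≤ c * w x) (x : Rn l) :
    Integrable f (law μ a N t x) :=
  ((hw.integrable x).const_mul c).mono' hf.aestronglyMeasurable (Eventually.of_forall hc)

theorem IsFellerWeight.abs_P_le (hw : IsFellerWeight μ a N t w) {f : Rn l → ℝ} {c : ℝ}
    (hc : ∀ x, |f x| ≤ c * w x) (x : Rn l) : |P μ a N t f x| ≤ c * P μ a N t w x := by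
  rw [P, P, ← integral_const_mul]
  exact norm_integral_le_of_norm_le (f := f) ((hw.integrable x).const_mul c) (Eventually.of_forall hc)

theorem IsFellerWeight.continuous_P_of_abs_le (hM : IsSmoothModel μ a N K)
    (hw : IsFellerWeight μ a N t w) {f : Rn l → ℝ} (hf : Continuous f) {c : ℝ}
    (hc : ∀ x, |f x| ≤ c * w x) : Continuous (P μ a N t f) := by
  have h : P μ a N t f = fun x => ∫ ω, f (state a N t x ω) ∂μ :=
    funext fun x => P_eq_integral hM.continuous hM.iid.meas t hf.measurable x
  rw [h]
  exact hw.continuous_integral hM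
    (fun x => hf.measurable.comp (measurable_state hM.continuous hM.iid.meas t x))
    (fun ω => hf.comp (continuous_state hM.contDiff t ω)) fun x ω => hc _

theorem IsSmoothModel.measurable_sens (hM : IsSmoothModel μ a N K) (t : ℕ) (x : Rn l)
    (i j : Fin l) : Measurable fun ω => sens a N t x ω i j :=
  (measurable_sens_uncurry hM.continuous hM.contDiff hM.iid.meas t i j).comp measurable_prodMk_left

theorem IsSmoothModel.abs_sens_mul_le (hM : IsSmoothModel μ a N K) (t : ℕ) {f : Rn l → ℝ}
    {c : ℝ} (hc : ∀ x, |f x| ≤ c * w x) (x : Rn l) (ω : Ω) (i j : Fin l) :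
    |sens a N t x ω i j * f (state a N t x ω)| ≤ K ^ t * c * w (state a N t x ω) := by
  rw [abs_mul, mul_assoc]
  exact mul_le_mul (abs_sens_le hM.contDiff hM.nonneg hM.norm_fderiv_le t ω x i j) (hc _)
    (abs_nonneg _) (pow_nonneg hM.nonneg t)

theorem IsFellerWeight.integrable_sens_mul (hM : IsSmoothModel μ a N K)
    (hw : IsFellerWeight μ a N t w) {f : Rn l → ℝ} (hf : Measurable f) {c : ℝ}
    (hc : ∀ x, |f x| ≤ c * w x) (x : Rn l) (i j : Fin l) :
    Integrable (fun ω => sens a N t x ω i j * f (state a N t x ω)) μ :=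
  hw.integrable_of_abs_le hM ((hM.measurable_sens t x i j).mul
    (hf.comp (measurable_state hM.continuous hM.iid.meas t x)))
    fun ω => hM.abs_sens_mul_le t hc x ω i j

theorem IsFellerWeight.continuous_Qij (hM : IsSmoothModel μ a N K)
    (hw : IsFellerWeight μ a N t w) {f : Rn l → ℝ} (hf : Continuous f) {c : ℝ}
    (hc : ∀ x, |f x| ≤ c * w x) (i j : Fin l) : Continuous (Qij μ a N t i j f) :=
  hw.continuous_integral hM (fun x => (hM.measurable_sens t x j i).mul
    (hf.measurable.comp (measurable_state hM.continuous hM.iid.meas t x)))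
    (fun ω => (continuous_sens hM.contDiff t ω j i).mul
      (hf.comp (continuous_state hM.contDiff t ω)))
    fun x ω => hM.abs_sens_mul_le t hc x ω j i

theorem IsFellerWeight.abs_Qij_le (hM : IsSmoothModel μ a N K)
    (hw : IsFellerWeight μ a N t w) {f : Rn l → ℝ} {c : ℝ}
    (hc : ∀ x, |f x| ≤ c * w x) (i j : Fin l) (x : Rn l) :
    |Qij μ a N t i j f x| ≤ K ^ t * c * P μ a N t w x :=
  hw.abs_integral_le hM fun ω => hM.abs_sens_mul_le t hc x ω j i

theorem gradient_apply {f : Rn l → ℝ} (hf : Differentiable ℝ f) (x : Rn l) (i : Fin l) :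
    gradient f x i = pd i f x := by
  have h := (hf x).hasGradientAt.hasFDerivAt.fderiv
  rw [pd, h, InnerProductSpace.toDual_apply_apply, EuclideanSpace.inner_single_right]
  simp

theorem Q_gradient_apply {f : Rn l → ℝ} (hf : Differentiable ℝ f) (x : Rn l) (i : Fin l) :
    Q μ a N t (gradient f) x i
      = ∫ ω, ∑ j, sens a N t x ω j i * pd j f (state a N t x ω) ∂μ := by
  simp only [Q, Matrix.mulVec, dotProduct, Matrix.transpose_apply, gradient_apply hf]

theorem IsFellerWeight.Q_gradient_apply_eq_sum (hM : IsSmoothModel μ a N K)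
    (hw : IsFellerWeight μ a N t w) {f : Rn l → ℝ} (hf : ContDiff ℝ 1 f) {c : ℝ}
    (hc : ∀ i x, |pd i f x| ≤ c * w x) (x : Rn l) (i : Fin l) :
    Q μ a N t (gradient f) x i = ∑ j, Qij μ a N t i j (pd j f) x := by
  rw [Q_gradient_apply (hf.differentiable (by simp)), integral_finsetSum]
  · rfl
  · exact fun j _ => hw.integrable_sens_mul hM (continuous_pd hf j).measurable (hc j) x j i

theorem IsFellerWeight.continuous_Q_gradient (hM : IsSmoothModel μ a N K)
    (hw : IsFellerWeight μ a N t w) {f : Rn l → ℝ} (hf : ContDiff ℝ 1 f) {c : ℝ}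
    (hc : ∀ i x, |pd i f x| ≤ c * w x) (i : Fin l) :
    Continuous fun x => Q μ a N t (gradient f) x i := by
  simp only [hw.Q_gradient_apply_eq_sum hM hf hc]
  exact continuous_finsetSum _ fun j _ => hw.continuous_Qij hM (continuous_pd hf j) (hc j) i j

theorem IsFellerWeight.abs_Q_gradient_le (hM : IsSmoothModel μ a N K)
    (hw : IsFellerWeight μ a N t w) {f : Rn l → ℝ} (hf : ContDiff ℝ 1 f) {c : ℝ}
    (hc : ∀ i x, |pd i f x| ≤ c * w x) (x : Rn l) (i : Fin l) :
    |Q μ a N t (gradient f) x i| ≤ l * K ^ t * c * P μ a N t w x := by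
  rw [hw.Q_gradient_apply_eq_sum hM hf hc]
  refine (Finset.abs_sum_le_sum_abs _ _).trans ?_
  refine (Finset.sum_le_sum fun j _ => hw.abs_Qij_le hM (hc j) i j x).trans_eq ?_
  simp only [Finset.sum_const, Finset.card_univ, Fintype.card_fin, nsmul_eq_mul]
  ring

/-- The derivative of `f (X(t))` at the initial condition `y` in the direction `h`. -/
def stateDeriv (a : Rn l → Rn m → Rn l) (N : ℕ → Ω → Rn m) (t : ℕ) (f : Rn l → ℝ)
    (h y : Rn l) (ω : Ω) : ℝ :=
  ∑ i, h i * ∑ j, sens a N t y ω j i * pd j f (state a N t y ω)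

theorem IsSmoothModel.measurable_stateDeriv (hM : IsSmoothModel μ a N K) (t : ℕ) {f : Rn l → ℝ}
    (hf : ContDiff ℝ 1 f) (h : Rn l) :
    Measurable fun z : Rn l × Ω => stateDeriv a N t f h z.1 z.2 := by
  refine Finset.measurable_fun_sum _ fun i _ => Measurable.const_mul
    (Finset.measurable_fun_sum _ fun j _ => ?_) _
  exact (measurable_sens_uncurry hM.continuous hM.contDiff hM.iid.meas t j i).mul
    ((continuous_pd hf j).measurable.comp
      (measurable_state_uncurry hM.continuous hM.iid.meas t))

theorem IsSmoothModel.continuous_stateDeriv (hM : IsSmoothModel μ a N K) (t : ℕ) {f : Rn l → ℝ}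
    (hf : ContDiff ℝ 1 f) (h : Rn l) (ω : Ω) : Continuous fun y => stateDeriv a N t f h y ω :=
  continuous_finsetSum _ fun i _ => continuous_const.mul <| continuous_finsetSum _ fun j _ =>
    (continuous_sens hM.contDiff t ω j i).mul
      ((continuous_pd hf j).comp (continuous_state hM.contDiff t ω))

theorem IsSmoothModel.abs_stateDeriv_le (hM : IsSmoothModel μ a N K) (t : ℕ) {f : Rn l → ℝ}
    {c : ℝ} (hc : ∀ i x, |pd i f x| ≤ c * w x) (h y : Rn l) (ω : Ω) :
    |stateDeriv a N t f h y ω|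
      ≤ (∑ i, |h i| * (l * (K ^ t * c))) * w (state a N t y ω) := by
  refine (Finset.abs_sum_le_sum_abs _ _).trans ?_
  rw [Finset.sum_mul]
  refine Finset.sum_le_sum fun i _ => ?_
  rw [abs_mul, mul_assoc]
  refine mul_le_mul_of_nonneg_left ((Finset.abs_sum_le_sum_abs _ _).trans ?_) (abs_nonneg _)
  refine (Finset.sum_le_sum fun j _ => hM.abs_sens_mul_le t (hc j) y ω j i).trans_eq ?_
  simp only [Finset.sum_const, Finset.card_univ, Fintype.card_fin, nsmul_eq_mul]
  ring

/-- The fundamental theorem of calculus along the segment from `x` to `x + h`, for each realization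
of the noise separately. -/
theorem IsSmoothModel.sub_eq_integral_stateDeriv (hM : IsSmoothModel μ a N K) (t : ℕ)
    {f : Rn l → ℝ} (hf : ContDiff ℝ 1 f) (x h : Rn l) (ω : Ω) :
    f (state a N t (x + h) ω) - f (state a N t x ω)
      = ∫ s in (0 : ℝ)..1, stateDeriv a N t f h (x + s • h) ω := by
  have hderiv : ∀ s ∈ Set.uIcc (0 : ℝ) 1, HasDerivAt
      (fun s : ℝ => f (state a N t (x + s • h) ω)) (stateDeriv a N t f h (x + s • h) ω) s := by
    intro s _
    obtain ⟨L, hL, hLh⟩ := hasFDerivAt_comp_state (N := N) hM.contDiff hf t ω (x + s • h)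
    have hl : HasDerivAt (fun s : ℝ => x + s • h) h s := by
      simpa using ((hasDerivAt_id s).smul_const h).const_add x
    have := hL.comp_hasDerivAt s hl
    rwa [hLh] at this
  have hline : Continuous fun s : ℝ => x + s • h := by fun_prop
  have := intervalIntegral.integral_eq_sub_of_hasDerivAt hderiv
    (((hM.continuous_stateDeriv t hf h ω).comp hline).intervalIntegrable 0 1)
  simpa using this.symm

theorem IsFellerWeight.integral_stateDeriv (hM : IsSmoothModel μ a N K)
    (hw : IsFellerWeight μ a N t w) {f : Rn l → ℝ} (hf : ContDiff ℝ 1 f) {c : ℝ}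
    (hc : ∀ i x, |pd i f x| ≤ c * w x) (h y : Rn l) :
    ∫ ω, stateDeriv a N t f h y ω ∂μ = ∑ i, h i * Q μ a N t (gradient f) y i := by
  have hi : ∀ j i, Integrable (fun ω => sens a N t y ω j i * pd j f (state a N t y ω)) μ :=
    fun j i => hw.integrable_sens_mul hM (continuous_pd hf j).measurable (hc j) y j i
  unfold stateDeriv
  rw [integral_finsetSum]
  · refine Finset.sum_congr rfl fun i _ => ?_
    rw [integral_const_mul, Q_gradient_apply (hf.differentiable (by simp))]
  · exact fun i _ => (integrable_finsetSum _ fun j _ => hi j i).const_mul _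

attribute [irreducible] stateDeriv

variable [IsProbabilityMeasure μ]

/-- The increment of `P^t f` along a segment is the integral of `Q^t ∇f`. -/
theorem IsFellerWeight.P_add_sub_P (hM : IsSmoothModel μ a N K)
    (hw : IsFellerWeight μ a N t w) {f : Rn l → ℝ} (hf : ContDiff ℝ 1 f) {c : ℝ}
    (hc₀ : ∀ x, |f x| ≤ c * w x) (hc : ∀ i x, |pd i f x| ≤ c * w x) (x h : Rn l) :
    P μ a N t f (x + h) - P μ a N t f x
      = ∫ s in (0 : ℝ)..1, ∑ i, h i * Q μ a N t (gradient f) (x + s • h) i := by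
  have hline : Continuous fun s : ℝ => x + s • h := by fun_prop
  have hDm := hM.measurable_stateDeriv t hf h
  have hDm' : ∀ y, Measurable fun ω => stateDeriv a N t f h y ω := fun y => by
    have := hDm.comp (measurable_prodMk_left (x := y))
    exact this
  have hDb := hM.abs_stateDeriv_le t hc h
  have hfi : ∀ y, Integrable (fun ω => f (state a N t y ω)) μ := fun y =>
    hw.integrable_of_abs_le hM (hf.continuous.measurable.comp
      (measurable_state hM.continuous hM.iid.meas t y)) fun ω => hc₀ _
  -- Integrability on the product of the segment and the probability space, needed for Fubini: the
  -- expected absolute value of the derivative is continuous in the initial condition, hence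
  -- integrable along the segment.
  have hprod : Integrable (Function.uncurry fun (s : ℝ) ω => stateDeriv a N t f h (x + s • h) ω)
      ((volume.restrict (Set.Ioc (0 : ℝ) 1)).prod μ) := by
    have hm : Measurable
        (Function.uncurry fun (s : ℝ) ω => stateDeriv a N t f h (x + s • h) ω) := by
      have := hDm.comp (((hline.measurable.comp measurable_fst).prodMk measurable_snd :
        Measurable fun z : ℝ × Ω => (x + z.1 • h, z.2)))
      exact this
    rw [integrable_prod_iff hm.aestronglyMeasurable]
    refine ⟨Eventually.of_forall fun s =>
      hw.integrable_of_abs_le hM (hDm' (x + s • h)) (hDb (x + s • h)), ?_⟩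
    have : Continuous fun y => ∫ ω, ‖stateDeriv a N t f h y ω‖ ∂μ :=
      hw.continuous_integral hM (fun y => (hDm' y).norm)
        (fun ω => (hM.continuous_stateDeriv t hf h ω).norm) fun y ω => by simpa using hDb y ω
    exact ((this.comp hline).integrableOn_Icc (a := 0) (b := 1)).mono_set Set.Ioc_subset_Icc_self
  rw [P_eq_integral hM.continuous hM.iid.meas t hf.continuous.measurable,
    P_eq_integral hM.continuous hM.iid.meas t hf.continuous.measurable,
    ← integral_sub (hfi _) (hfi _)]
  simp only [hM.sub_eq_integral_stateDeriv t hf, intervalIntegral.integral_of_le zero_le_one]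
  rw [← integral_integral_swap hprod]
  simp only [hw.integral_stateDeriv hM hf hc]

/-- No domination of difference quotients is needed. An increment of `P^t f` is the integral of `Q^t
∇f` along a segment, and a continuous field with this property is the gradient. -/
theorem IsFellerWeight.hasGradientAt_P (hM : IsSmoothModel μ a N K)
    (hw : IsFellerWeight μ a N t w) {f : Rn l → ℝ} (hf : ContDiff ℝ 1 f) {c : ℝ}
    (hc₀ : ∀ x, |f x| ≤ c * w x) (hc : ∀ i x, |pd i f x| ≤ c * w x) (x : Rn l) :
    HasGradientAt (P μ a N t f) (Q μ a N t (gradient f) x) x := by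
  set q : Rn l → Fin l → ℝ := fun y i => Q μ a N t (gradient f) y i with hq
  have hqc : ∀ i, Continuous fun y => q y i := hw.continuous_Q_gradient hM hf hc
  have hinner : ∀ h : Rn l, InnerProductSpace.toDual ℝ (Rn l) (Q μ a N t (gradient f) x) h
      = ∑ i, h i * q x i := fun h => by
    rw [InnerProductSpace.toDual_apply_apply, PiLp.inner_apply]
    simp [hq]
  rw [hasGradientAt_iff_hasFDerivAt, hasFDerivAt_iff_isLittleO_nhds_zero,
    Asymptotics.isLittleO_iff]
  intro ε hε
  have hφ : Continuous fun y => ∑ i, |q y i - q x i| :=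
    continuous_finsetSum _ fun i _ => ((hqc i).sub continuous_const).abs
  have hev : ∀ᶠ y in 𝓝 x, ∑ i, |q y i - q x i| < ε := by
    refine (hφ.tendsto x).eventually (gt_mem_nhds ?_)
    simpa using hε
  obtain ⟨r, hr, hball⟩ := Metric.eventually_nhds_iff_ball.1 hev
  filter_upwards [Metric.ball_mem_nhds 0 hr] with h hh
  rw [hw.P_add_sub_P hM hf hc₀ hc, hinner]
  have hline : Continuous fun s : ℝ => x + s • h := by fun_prop
  have hi : IntervalIntegrable (fun s : ℝ => ∑ i, h i * q (x + s • h) i) volume 0 1 :=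
    (continuous_finsetSum _ fun i _ =>
      continuous_const.mul ((hqc i).comp hline)).intervalIntegrable 0 1
  have heq : (∫ s in (0 : ℝ)..1, ∑ i, h i * q (x + s • h) i) - ∑ i, h i * q x i
      = ∫ s in (0 : ℝ)..1, (∑ i, h i * q (x + s • h) i - ∑ i, h i * q x i) := by
    rw [intervalIntegral.integral_sub hi intervalIntegrable_const]
    simp
  rw [heq]
  refine (intervalIntegral.norm_integral_le_of_norm_le_const (C := ε * ‖h‖) fun s hs => ?_).trans
    (by simp)
  rw [Set.uIoc_of_le zero_le_one] at hs
  have hmem : x + s • h ∈ Metric.ball x r := by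
    rw [mem_ball_iff_norm, add_sub_cancel_left, norm_smul, Real.norm_of_nonneg hs.1.le]
    have := mem_ball_zero_iff.1 hh
    nlinarith [norm_nonneg h, hs.2]
  rw [← Finset.sum_sub_distrib]
  refine (norm_sum_le _ _).trans ?_
  calc ∑ i, ‖h i * q (x + s • h) i - h i * q x i‖
      ≤ ∑ i, ‖h‖ * |q (x + s • h) i - q x i| := by
        refine Finset.sum_le_sum fun i _ => ?_
        rw [← mul_sub, norm_mul]
        exact mul_le_mul_of_nonneg_right (PiLp.norm_apply_le h i) (norm_nonneg _)
    _ = (∑ i, |q (x + s • h) i - q x i|) * ‖h‖ := by rw [← Finset.mul_sum, mul_comm]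
    _ ≤ ε * ‖h‖ := mul_le_mul_of_nonneg_right (hball _ hmem).le (norm_nonneg _)

theorem IsFellerWeight.pd_P (hM : IsSmoothModel μ a N K)
    (hw : IsFellerWeight μ a N t w) {f : Rn l → ℝ} (hf : ContDiff ℝ 1 f) {c : ℝ}
    (hc₀ : ∀ x, |f x| ≤ c * w x) (hc : ∀ i x, |pd i f x| ≤ c * w x) (x : Rn l) (i : Fin l) :
    pd i (P μ a N t f) x = Q μ a N t (gradient f) x i := by
  have h := (hw.hasGradientAt_P hM hf hc₀ hc x)
  rw [← gradient_apply (fun y => (hw.hasGradientAt_P hM hf hc₀ hc y).differentiableAt), h.gradient]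

theorem IsFellerWeight.contDiff_P (hM : IsSmoothModel μ a N K)
    (hw : IsFellerWeight μ a N t w) {f : Rn l → ℝ} (hf : ContDiff ℝ 1 f) {c : ℝ}
    (hc₀ : ∀ x, |f x| ≤ c * w x) (hc : ∀ i x, |pd i f x| ≤ c * w x) :
    ContDiff ℝ 1 (P μ a N t f) := by
  have h := hw.hasGradientAt_P hM hf hc₀ hc
  rw [contDiff_one_iff_fderiv]
  refine ⟨fun x => (h x).differentiableAt, ?_⟩
  have heq : fderiv ℝ (P μ a N t f)
      = fun x => InnerProductSpace.toDual ℝ (Rn l) (Q μ a N t (gradient f) x) :=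
    funext fun x => (h x).hasFDerivAt.fderiv
  rw [heq]
  refine (InnerProductSpace.toDual ℝ (Rn l)).continuous.comp ?_
  exact (PiLp.continuous_toLp 2 _).comp
    (continuous_pi fun i => hw.continuous_Q_gradient hM hf hc i)

theorem IsFellerWeight.abs_pd_P_le (hM : IsSmoothModel μ a N K)
    (hw : IsFellerWeight μ a N t w) {f : Rn l → ℝ} (hf : ContDiff ℝ 1 f) {c : ℝ}
    (hc₀ : ∀ x, |f x| ≤ c * w x) (hc : ∀ i x, |pd i f x| ≤ c * w x) (x : Rn l) (i : Fin l) :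
    |pd i (P μ a N t f) x| ≤ l * K ^ t * c * P μ a N t w x := by
  rw [hw.pd_P hM hf hc₀ hc]
  exact hw.abs_Q_gradient_le hM hf hc x i

end Core

/-! ### Weights satisfying a drift condition -/

/-- `p` is a `C¹` density of `P^t`. -/
structure IsC1Density (μ : Measure Ω) (a : Rn l → Rn m → Rn l) (N : ℕ → Ω → Rn m) (t : ℕ)
    (p : Rn l × Rn l → ℝ) : Prop where
  contDiff : ContDiff ℝ 1 p
  nonneg : ∀ z, 0 ≤ p z
  law_apply : ∀ x (A : Set (Rn l)), MeasurableSet A →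
    law μ a N t x A = ∫⁻ y in A, ENNReal.ofReal (p (x, y))

/-- A continuous weight `w ≥ 1` with `P w ≤ B u w`, where `0 ≤ u ≤ 1` vanishes at infinity. -/
structure IsDriftWeight (μ : Measure Ω) (a : Rn l → Rn m → Rn l) (N : ℕ → Ω → Rn m)
    (w u : Rn l → ℝ) (B : ℝ) : Prop where
  continuous : Continuous w
  one_le : ∀ x, 1 ≤ w x
  continuous_decay : Continuous u
  decay_nonneg : ∀ x, 0 ≤ u x
  decay_le_one : ∀ x, u x ≤ 1
  tendsto_decay : Tendsto u (cocompact (Rn l)) (𝓝 0)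
  one_le_const : 1 ≤ B
  integrable_one : ∀ x, Integrable w (law μ a N 1 x)
  P_one_le : ∀ x, P μ a N 1 w x ≤ B * (u x * w x)

theorem tendsto_cocompact_atTop_of_isCompact_sublevel {V : Rn l → ℝ}
    (hV : ∀ r : ℝ, IsCompact {x | V x ≤ r}) : Tendsto V (cocompact (Rn l)) atTop := by
  refine tendsto_atTop.2 fun r => ?_
  filter_upwards [(hV r).compl_mem_cocompact] with x hx
  exact le_of_lt (by simpa using hx)

section Drift

variable {μ : Measure Ω} {a : Rn l → Rn m → Rn l} {N : ℕ → Ω → Rn m}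
  {K : ℝ} {t : ℕ} {w u : Rn l → ℝ} {B : ℝ}

theorem P_mono {f g : Rn l → ℝ} {x : Rn l} (hf : Integrable f (law μ a N t x))
    (hg : Integrable g (law μ a N t x)) (h : ∀ y, f y ≤ g y) : P μ a N t f x ≤ P μ a N t g x :=
  integral_mono hf hg h

theorem P_const_mul (c : ℝ) (f : Rn l → ℝ) (x : Rn l) :
    P μ a N t (fun y => c * f y) x = c * P μ a N t f x := integral_const_mul _ _

theorem IsDriftWeight.pos (hw : IsDriftWeight μ a N w u B) (x : Rn l) : 0 < w x :=
  one_pos.trans_le (hw.one_le x)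

theorem IsDriftWeight.decay_mul_le (hw : IsDriftWeight μ a N w u B) (x : Rn l) : u x * w x ≤ w x :=
  mul_le_of_le_one_left (hw.pos x).le (hw.decay_le_one x)

theorem IsDriftWeight.const_nonneg (hw : IsDriftWeight μ a N w u B) : 0 ≤ B := zero_le_one.trans hw.one_le_const

theorem IsDriftWeight.P_nonneg (hw : IsDriftWeight μ a N w u B) (t : ℕ) (x : Rn l) : 0 ≤ P μ a N t w x :=
  integral_nonneg fun z => (hw.pos z).le

theorem IsC1Density.P_eq {p : Rn l × Rn l → ℝ} (hp : IsC1Density μ a N t p) (f : Rn l → ℝ)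
    (x : Rn l) : P μ a N t f x = ∫ y, p (x, y) * f y := by
  have hpm : Measurable fun y => p (x, y) :=
    (hp.contDiff.continuous.comp (continuous_const.prodMk continuous_id)).measurable
  have hlaw : law μ a N t x = volume.withDensity fun y => ENNReal.ofReal (p (x, y)) := by
    ext A hA
    rw [hp.law_apply x A hA, withDensity_apply _ hA]
  rw [P, hlaw, integral_withDensity_eq_integral_toReal_smul hpm.ennreal_ofReal
    (Eventually.of_forall fun y => ENNReal.ofReal_lt_top)]
  simp only [ENNReal.toReal_ofReal (hp.nonneg _), smul_eq_mul]

/-- The strong Feller effect of the density: the dependence on `x` sits in `p`, which is bounded on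
a neighbourhood of `x₀` times `S`, so `f` need only be measurable and bounded. -/
theorem IsC1Density.continuous_P_of_bounded {p : Rn l × Rn l → ℝ} (hp : IsC1Density μ a N t p)
    {S : Set (Rn l)} (hS : IsCompact S) {f : Rn l → ℝ} (hf : Measurable f) {M : ℝ}
    (hfM : ∀ x, |f x| ≤ M) (hfS : ∀ x, x ∉ S → f x = 0) : Continuous (P μ a N t f) := by
  have hpc := hp.contDiff.continuous
  have hcomm : P μ a N t f = fun x => ∫ y, p (x, y) * f y := funext (hp.P_eq f)
  rw [hcomm]
  refine continuous_iff_continuousAt.2 fun x₀ => ?_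
  obtain ⟨M', hM'⟩ := ((isCompact_closedBall x₀ 1).prod hS).exists_bound_of_continuousOn
    hpc.continuousOn
  refine continuousAt_of_dominated (bound := S.indicator fun _ => M' * M) ?_ ?_ ?_ ?_
  · exact Eventually.of_forall fun x => ((hpc.comp (continuous_const.prodMk
      continuous_id)).measurable.mul hf).aestronglyMeasurable
  · filter_upwards [Metric.closedBall_mem_nhds x₀ one_pos] with x hx
    refine Eventually.of_forall fun y => ?_
    by_cases hy : y ∈ S
    · rw [Set.indicator_of_mem hy, norm_mul]
      have h1 := hM' (x, y) ⟨hx, hy⟩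
      exact mul_le_mul h1 (hfM y) (norm_nonneg _) ((norm_nonneg _).trans h1)
    · simp [hfS y hy, hy]
  · exact (integrable_indicator_iff hS.measurableSet).2
      (integrableOn_const hS.measure_lt_top.ne)
  · exact Eventually.of_forall fun y =>
      ((hpc.comp (continuous_id.prodMk continuous_const)).mul continuous_const).continuousAt

variable [IsProbabilityMeasure μ]

/-- Jensen's inequality for the power `η`, obtained by integrating the convexity bound `exp(η s) ≤ η
exp(s) + 1 - η` at `s = V - α`. The same bound gives integrability. -/
theorem integral_exp_mul_le {X : Type*} [MeasurableSpace X] {ν : Measure X}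
    [IsProbabilityMeasure ν] {V : X → ℝ} (hVm : Measurable V)
    (hV : Integrable (fun y => Real.exp (V y)) ν) {α η : ℝ} (hα : ∫ y, Real.exp (V y) ∂ν ≤ Real.exp α)
    (h0 : 0 ≤ η) (h1 : η ≤ 1) : Integrable (fun y => Real.exp (η * V y)) ν ∧
      ∫ y, Real.exp (η * V y) ∂ν ≤ Real.exp (η * α) := by
  have hb : ∀ y, Real.exp (η * V y)
      ≤ Real.exp (η * α) * (η * (Real.exp (-α) * Real.exp (V y)) + (1 - η)) := fun y => by
    have h := convexOn_exp.2 (Set.mem_univ (V y - α)) (Set.mem_univ 0) h0 (sub_nonneg.2 h1) (by ring)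
    simp only [smul_eq_mul, mul_zero, add_zero, Real.exp_zero, mul_one] at h
    calc Real.exp (η * V y) = Real.exp (η * α) * Real.exp (η * (V y - α)) := by
          rw [← Real.exp_add]; ring_nf
      _ ≤ _ := by
          rw [← Real.exp_add (-α), neg_add_eq_sub]
          exact mul_le_mul_of_nonneg_left h (Real.exp_pos _).le
  have hi : Integrable (fun y =>
      Real.exp (η * α) * (η * (Real.exp (-α) * Real.exp (V y)) + (1 - η))) ν :=
    (((hV.const_mul _).const_mul _).add (integrable_const _)).const_mul _
  have hi' : Integrable (fun y => Real.exp (η * V y)) ν := by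
    refine hi.mono' (by fun_prop) (Eventually.of_forall fun y => ?_)
    rw [Real.norm_of_nonneg (Real.exp_pos _).le]
    exact hb y
  refine ⟨hi', (integral_mono hi' hi hb).trans ?_⟩
  rw [integral_const_mul, integral_add ((hV.const_mul _).const_mul _) (integrable_const _),
    integral_const_mul, integral_const_mul]
  have h2 : Real.exp (-α) * ∫ y, Real.exp (V y) ∂ν ≤ 1 := by
    calc _ ≤ Real.exp (-α) * Real.exp α := mul_le_mul_of_nonneg_left hα (Real.exp_pos _).le
      _ = 1 := by rw [← Real.exp_add]; simp
  refine mul_le_of_le_one_right (Real.exp_pos _).le ?_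
  simp only [integral_const, probReal_univ, smul_eq_mul, one_mul]
  nlinarith

/-- Raising `P e^V ≤ exp(V - δ W + |b|)` to the power `η` by Jensen gives `u = exp(-η δ W)` and `B =
exp(η |b|)`. Positivity of `V` gives weight at least `1`, and compact sublevel sets of `W` give
decay of `u`. -/
theorem A4.exists_isDriftWeight {V : Rn l → ℝ} (hM : IsSmoothModel μ a N K) (h4 : A4 μ a N V)
    {η : ℝ} (h0 : 0 < η) (h1 : η ≤ 1) : ∃ u B, IsDriftWeight μ a N (weight V η) u B := by
  obtain ⟨hV0, hV, -, W, hW1, hW, hWc, hint, C, δ, b, -, hδ, hdrift⟩ := h4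
  have hprob := isProbabilityMeasure_law (μ := μ) hM.continuous hM.iid.meas 1
  refine ⟨fun x => Real.exp (-(η * δ * W x)), Real.exp (η * |b|), ?_⟩
  have hPV : ∀ x, P μ a N 1 (fun y => Real.exp (V y)) x ≤ Real.exp (V x - δ * W x + |b|) := by
    intro x
    have hpos : 0 < P μ a N 1 (fun y => Real.exp (V y)) x := integral_exp_pos (hint x)
    rw [← Real.log_le_iff_le_exp hpos]
    -- The sign of `b` is not prescribed, so `|b|` is the bound both on and off `C`.
    have hC : b * C.indicator (fun _ => (1 : ℝ)) x ≤ |b| := by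
      by_cases hx : x ∈ C
      · simp [hx, le_abs_self]
      · simp [hx]
    linarith [hdrift x]
  have key := fun x => integral_exp_mul_le hV.continuous.measurable (hint x) (hPV x) h0.le h1
  have hηδ : 0 < η * δ := mul_pos h0 hδ
  exact
    { continuous := Real.continuous_exp.comp (continuous_const.mul hV.continuous)
      one_le := fun x => Real.one_le_exp (mul_pos h0 (hV0 x)).le
      continuous_decay := Real.continuous_exp.comp (continuous_const.mul hW.continuous).neg
      decay_nonneg := fun x => (Real.exp_pos _).le
      decay_le_one := fun x => Real.exp_le_one_iff.2
        (neg_nonpos.2 (mul_nonneg hηδ.le (zero_le_one.trans (hW1 x))))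
      tendsto_decay := Real.tendsto_exp_neg_atTop_nhds_zero.comp
        ((tendsto_cocompact_atTop_of_isCompact_sublevel hWc).const_mul_atTop hηδ)
      one_le_const := Real.one_le_exp (mul_nonneg h0.le (abs_nonneg b))
      integrable_one := fun x => (key x).1
      P_one_le := fun x => (key x).2.trans_eq <| by
        rw [weight, ← Real.exp_add, ← Real.exp_add]
        ring_nf }

/-- `P_add` presupposes integrability under the law at time `t + s`. It is obtained here from
Tonelli's theorem for nonnegative functions. -/
theorem integrable_law_add (hM : IsSmoothModel μ a N K) (t s : ℕ) (x : Rn l) {f g : Rn l → ℝ}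
    (hf : Measurable f) (hf0 : ∀ y, 0 ≤ f y) (hfi : ∀ y, Integrable f (law μ a N s y))
    (hfg : ∀ y, P μ a N s f y ≤ g y) (hg : Integrable g (law μ a N t x)) :
    Integrable f (law μ a N (t + s) x) := by
  refine ⟨hf.aestronglyMeasurable, ?_⟩
  rw [hasFiniteIntegral_iff_ofReal (Eventually.of_forall hf0),
    lintegral_law_add hM.continuous hM.iid t s x hf.ennreal_ofReal]
  have hg0 : ∀ y, 0 ≤ g y := fun y => (integral_nonneg hf0).trans (hfg y)
  refine lt_of_le_of_lt (lintegral_mono fun y => ?_)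
    ((hasFiniteIntegral_iff_ofReal (Eventually.of_forall hg0)).1 hg.2)
  rw [← ofReal_integral_eq_lintegral_ofReal (hfi y) (Eventually.of_forall hf0)]
  exact ENNReal.ofReal_le_ofReal (hfg y)

namespace IsDriftWeight

theorem integrable_and_P_le (hM : IsSmoothModel μ a N K) (hw : IsDriftWeight μ a N w u B)
    (t : ℕ) (x : Rn l) : Integrable w (law μ a N t x) ∧ P μ a N t w x ≤ B ^ t * w x := by
  induction t with
  | zero =>
    rw [P, law_zero]
    exact ⟨integrable_dirac (by simp), by simp⟩
  | succ t ih =>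
    have hb : ∀ y, P μ a N 1 w y ≤ B * w y := fun y =>
      (hw.P_one_le y).trans (mul_le_mul_of_nonneg_left (hw.decay_mul_le y) hw.const_nonneg)
    have hi := integrable_law_add hM t 1 x hw.continuous.measurable (fun y => (hw.pos y).le)
      hw.integrable_one hb (ih.1.const_mul B)
    refine ⟨hi, ?_⟩
    have hP : Integrable (P μ a N 1 w) (law μ a N t x) :=
      (ih.1.const_mul B).mono'
        (measurable_P hM.continuous hM.iid.meas 1 hw.continuous.measurable).aestronglyMeasurable
        (Eventually.of_forall fun y => by
          rw [Real.norm_of_nonneg (hw.P_nonneg 1 y)]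
          exact hb y)
    rw [P_add hM.continuous hM.iid t 1 x hi]
    calc P μ a N t (P μ a N 1 w) x ≤ P μ a N t (fun y => B * w y) x :=
          P_mono hP (ih.1.const_mul B) hb
      _ = B * P μ a N t w x := P_const_mul _ _ _
      _ ≤ B * (B ^ t * w x) := mul_le_mul_of_nonneg_left ih.2 hw.const_nonneg
      _ = B ^ (t + 1) * w x := by ring

theorem integrable (hM : IsSmoothModel μ a N K) (hw : IsDriftWeight μ a N w u B)
    (t : ℕ) (x : Rn l) : Integrable w (law μ a N t x) := (hw.integrable_and_P_le hM t x).1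

theorem P_le (hM : IsSmoothModel μ a N K) (hw : IsDriftWeight μ a N w u B)
    (t : ℕ) (x : Rn l) : P μ a N t w x ≤ B ^ t * w x := (hw.integrable_and_P_le hM t x).2

theorem measurable_P (hM : IsSmoothModel μ a N K) (hw : IsDriftWeight μ a N w u B) (t : ℕ) :
    Measurable (P μ a N t w) :=
  WeightedSobolev.measurable_P hM.continuous hM.iid.meas t hw.continuous.measurable

/-- The decay factor comes from the first transition out of `x`; the other `t - 1` transitions cost
only powers of `B`. -/
theorem P_le_decay (hM : IsSmoothModel μ a N K) (hw : IsDriftWeight μ a N w u B)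
    (ht : 1 ≤ t) (x : Rn l) : P μ a N t w x ≤ B ^ t * (u x * w x) := by
  obtain ⟨s, rfl⟩ := Nat.exists_eq_add_of_le ht
  rw [P_add hM.continuous hM.iid 1 s x (hw.integrable hM _ x)]
  have hi := (hw.integrable hM 1 x).const_mul (B ^ s)
  calc P μ a N 1 (P μ a N s w) x ≤ P μ a N 1 (fun y => B ^ s * w y) x := by
        refine P_mono (hi.mono' (hw.measurable_P hM s).aestronglyMeasurable
          (Eventually.of_forall fun y => ?_)) hi (hw.P_le hM s)
        rw [Real.norm_of_nonneg (hw.P_nonneg s y)]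
        exact hw.P_le hM s y
    _ = B ^ s * P μ a N 1 w x := P_const_mul _ _ _
    _ ≤ B ^ s * (B * (u x * w x)) :=
        mul_le_mul_of_nonneg_left (hw.P_one_le x) (pow_nonneg hw.const_nonneg s)
    _ = _ := by ring

/-- If `|f| ≤ c w`, then `|P^t f| ≤ c B^t w`. -/
theorem abs_P_le (hM : IsSmoothModel μ a N K) (hw : IsDriftWeight μ a N w u B) {f : Rn l → ℝ}
    {c : ℝ} (hc0 : 0 ≤ c) (hc : ∀ x, |f x| ≤ c * w x) (t : ℕ) (x : Rn l) :
    |P μ a N t f x| ≤ c * (B ^ t * w x) := by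
  refine le_trans ?_ (mul_le_mul_of_nonneg_left (hw.P_le hM t x) hc0)
  rw [P, P, ← integral_const_mul]
  exact norm_integral_le_of_norm_le (f := f) ((hw.integrable hM t x).const_mul c)
    (Eventually.of_forall hc)

theorem integrable_of_abs_le (hM : IsSmoothModel μ a N K) (hw : IsDriftWeight μ a N w u B)
    {f : Rn l → ℝ} (hf : Measurable f) {c : ℝ} (hc : ∀ x, |f x| ≤ c * w x) (t : ℕ) (x : Rn l) :
    Integrable f (law μ a N t x) :=
  ((hw.integrable hM t x).const_mul c).mono' hf.aestronglyMeasurable (Eventually.of_forall hc)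

/-- Continuity of `P^t f`, from approximations of `f` in the weighted norm. -/
theorem continuous_P_of_approx (hM : IsSmoothModel μ a N K) (hw : IsDriftWeight μ a N w u B)
    (t : ℕ) {f : Rn l → ℝ} (hf : ∀ x, Integrable f (law μ a N t x))
    (happ : ∀ ε, 0 < ε → ∃ g, (∀ x, Integrable g (law μ a N t x)) ∧ Continuous (P μ a N t g) ∧
      ∀ x, |f x - g x| ≤ ε * w x) : Continuous (P μ a N t f) := by
  have hB : ∀ x, 0 < B ^ t * w x := fun x =>
    mul_pos (pow_pos (one_pos.trans_le hw.one_le_const) t) (hw.pos x)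
  have hBc : Continuous fun x => B ^ t * w x := continuous_const.mul hw.continuous
  -- After division by `B^t w`, an approximation of `f` in the weighted norm becomes a uniform
  -- approximation of `P^t f`, and uniform limits of continuous functions are continuous.
  have hlim : Continuous fun x => P μ a N t f x / (B ^ t * w x) := by
    refine continuous_of_uniform_approx_of_continuous fun U hU => ?_
    obtain ⟨ε, hε, hεU⟩ := Metric.mem_uniformity_dist.1 hU
    obtain ⟨g, hgi, hg, hfg⟩ := happ (ε / 2) (by positivity)
    refine ⟨fun x => P μ a N t g x / (B ^ t * w x), hg.div hBc fun x => (hB x).ne', fun x => ?_⟩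
    refine hεU ?_
    have hsub : P μ a N t f x - P μ a N t g x = P μ a N t (fun y => f y - g y) x :=
      (integral_sub (hf x) (hgi x)).symm
    rw [Real.dist_eq, ← sub_div, abs_div, abs_of_pos (hB x), div_lt_iff₀ (hB x), hsub]
    refine (hw.abs_P_le hM (by positivity) hfg t x).trans_lt ?_
    exact mul_lt_mul_of_pos_right (by linarith) (hB x)
  have heq : P μ a N t f = fun x => P μ a N t f x / (B ^ t * w x) * (B ^ t * w x) :=
    funext fun x => (div_mul_cancel₀ _ (hB x).ne').symm
  rw [heq]
  exact hlim.mul hBc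

/-- `P^t f` is continuous for continuous `f` that are negligible with respect to `w`
at infinity. -/
theorem continuous_P_of_negligible (hM : IsSmoothModel μ a N K) (hw : IsDriftWeight μ a N w u B)
    (t : ℕ) {f ρ : Rn l → ℝ} (hf : Continuous f) (hρ : Tendsto ρ (cocompact (Rn l)) (𝓝 0))
    (hfρ : ∀ x, |f x| ≤ ρ x * w x) {c : ℝ} (hc : ∀ x, |f x| ≤ c * w x) :
    Continuous (P μ a N t f) := by
  have hprob := isProbabilityMeasure_law (μ := μ) hM.continuous hM.iid.meas t
  -- The constant weight `1` encodes the ordinary Feller property on bounded continuous functions.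
  have hone : IsFellerWeight μ a N t fun _ => (1 : ℝ) :=
    ⟨continuous_const, fun x => integrable_const 1, by unfold P; simpa using continuous_const⟩
  refine hw.continuous_P_of_approx hM t (hw.integrable_of_abs_le hM hf.measurable hc t)
    fun ε hε => ?_
  -- Subtracting from `f` its truncation at the levels `±ε w` leaves a continuous function that
  -- vanishes where `ρ < ε`, hence has compact support. The truncation itself is the error, of size
  -- at most `ε w`.
  set g : Rn l → ℝ := fun x => f x - max (-(ε * w x)) (min (f x) (ε * w x)) with hg
  have hwc := hw.continuous
  have hgc : Continuous g := by fun_prop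
  obtain ⟨S, hS, hSρ⟩ := mem_cocompact.1 (hρ.eventually (gt_mem_nhds hε))
  have hgs : HasCompactSupport g := by
    refine HasCompactSupport.intro hS fun x hx => ?_
    have h1 : ρ x < ε := hSρ hx
    have h2 := abs_le.1 ((hfρ x).trans (mul_le_mul_of_nonneg_right h1.le (hw.pos x).le))
    simp only [hg]
    rw [min_eq_left h2.2, max_eq_right h2.1, sub_self]
  obtain ⟨M, hMb⟩ := hgs.exists_bound_of_continuous hgc
  have hgb : ∀ x, |g x| ≤ M * 1 := fun x => by simpa using hMb x
  refine ⟨g, hone.integrable_law hgc.measurable hgb, hone.continuous_P_of_abs_le hM hgc hgb,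
    fun x => ?_⟩
  have hεw : 0 < ε * w x := mul_pos hε (hw.pos x)
  simp only [hg, sub_sub_cancel]
  rw [abs_le]
  exact ⟨le_max_left _ _, max_le (by linarith) (min_le_right _ _)⟩

theorem isFellerWeight_of_negligible (hM : IsSmoothModel μ a N K)
    (hw : IsDriftWeight μ a N w u B) (t : ℕ) {ρ : Rn l → ℝ} (hρc : Continuous ρ)
    (hρ : Tendsto ρ (cocompact (Rn l)) (𝓝 0)) (hρ0 : ∀ x, 0 ≤ ρ x) (hρ1 : ∀ x, ρ x ≤ 1) :
    IsFellerWeight μ a N t fun x => ρ x * w x := by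
  have hc : Continuous fun x => ρ x * w x := hρc.mul hw.continuous
  have hb : ∀ x, |ρ x * w x| ≤ ρ x * w x := fun x =>
    (abs_of_nonneg (mul_nonneg (hρ0 x) (hw.pos x).le)).le
  have hb' : ∀ x, |ρ x * w x| ≤ 1 * w x := fun x =>
    (hb x).trans (mul_le_mul_of_nonneg_right (hρ1 x) (hw.pos x).le)
  exact ⟨hc, hw.integrable_of_abs_le hM hc.measurable hb' t,
    hw.continuous_P_of_negligible hM t hc hρ hb hb'⟩

end IsDriftWeight

/-- Past the time at which `P^t` has a density, a drift weight has a continuous expectation. -/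
theorem IsDriftWeight.isFellerWeight (hM : IsSmoothModel μ a N K) (hw : IsDriftWeight μ a N w u B)
    {t₀ : ℕ} {p : Rn l × Rn l → ℝ} (hp : IsC1Density μ a N t₀ p) (ht : t₀ + 1 ≤ t) :
    IsFellerWeight μ a N t w := by
  refine ⟨hw.continuous, hw.integrable hM t, ?_⟩
  obtain ⟨s, hs, rfl⟩ : ∃ s, 1 ≤ s ∧ t = t₀ + s := ⟨t - t₀, by omega, by omega⟩
  have hB : 0 ≤ B ^ s := pow_nonneg hw.const_nonneg s
  have heq : P μ a N (t₀ + s) w = P μ a N t₀ (P μ a N s w) :=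
    funext fun x => P_add hM.continuous hM.iid t₀ s x (hw.integrable hM _ x)
  rw [heq]
  have hm := hw.measurable_P hM s
  have hb : ∀ x, |P μ a N s w x| ≤ B ^ s * w x := fun x => by
    rw [abs_of_nonneg (hw.P_nonneg s x)]
    exact hw.P_le hM s x
  -- As `s ≥ 1`, `P^s w` is below `ε w` off a compact set `S`. On `S` it is bounded but only known
  -- to be measurable, so it is cut off by an indicator and the density of `P^{t₀}` supplies the
  -- continuity.
  refine hw.continuous_P_of_approx hM t₀ (hw.integrable_of_abs_le hM hm hb t₀) fun ε hε => ?_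
  have hρ : Tendsto (fun x => B ^ s * u x) (cocompact (Rn l)) (𝓝 0) := by
    simpa using hw.tendsto_decay.const_mul (B ^ s)
  obtain ⟨S, hS, hSρ⟩ := mem_cocompact.1 (hρ.eventually (gt_mem_nhds hε))
  have hle : ∀ x, |S.indicator (P μ a N s w) x| ≤ B ^ s * w x := fun x => by
    by_cases hx : x ∈ S
    · simpa [hx] using hb x
    · simpa [hx] using mul_nonneg hB (hw.pos x).le
  have hgm : Measurable (S.indicator (P μ a N s w)) := hm.indicator hS.measurableSet
  obtain ⟨M, hMb⟩ := hS.exists_bound_of_continuousOn (hw.continuous.continuousOn)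
  refine ⟨S.indicator (P μ a N s w), hw.integrable_of_abs_le hM hgm hle t₀,
    hp.continuous_P_of_bounded hS hgm (M := B ^ s * max M 0) (fun x => ?_)
      (fun x hx => Set.indicator_of_notMem hx _), fun x => ?_⟩
  · by_cases hx : x ∈ S
    · refine (hle x).trans (mul_le_mul_of_nonneg_left ?_ hB)
      exact (le_abs_self _).trans ((hMb x hx).trans (le_max_left _ _))
    · simpa [hx] using mul_nonneg hB (le_max_right M 0)
  · by_cases hx : x ∈ S
    · simpa [hx] using mul_nonneg hε.le (hw.pos x).le
    · have h1 : B ^ s * u x < ε := hSρ hx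
      rw [Set.indicator_of_notMem hx, sub_zero, abs_of_nonneg (hw.P_nonneg s x)]
      refine (hw.P_le_decay hM hs x).trans ?_
      rw [← mul_assoc]
      exact mul_le_mul_of_nonneg_right h1.le (hw.pos x).le

/-- Here `v^η = exp(-(1-η) V) v` with a prefactor vanishing at infinity, so `v^η` is negligible
against the drift weight `v`. No density is involved, hence no restriction on `t`. -/
theorem A4.isFellerWeight_of_lt_one {V : Rn l → ℝ} (hM : IsSmoothModel μ a N K)
    (h4 : A4 μ a N V) {η : ℝ} (h1 : η < 1) (t : ℕ) :
    IsFellerWeight μ a N t (weight V η) := by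
  obtain ⟨u, B, hw⟩ := h4.exists_isDriftWeight hM one_pos le_rfl
  obtain ⟨hV0, hV, hVc, -⟩ := h4
  have hη : 0 < 1 - η := by linarith
  have h := hw.isFellerWeight_of_negligible hM t (ρ := fun x => Real.exp (-((1 - η) * V x)))
    (Real.continuous_exp.comp (continuous_const.mul hV.continuous).neg)
    (Real.tendsto_exp_neg_atTop_nhds_zero.comp
      ((tendsto_cocompact_atTop_of_isCompact_sublevel hVc).const_mul_atTop hη))
    (fun x => (Real.exp_pos _).le)
    (fun x => Real.exp_le_one_iff.2 (neg_nonpos.2 (mul_pos hη (hV0 x)).le))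
  convert h using 2 with x
  rw [weight, weight, ← Real.exp_add]
  ring_nf

/-! ### The semigroups as operators on the weighted spaces -/

theorem conclA_of_isFellerWeight (hM : IsSmoothModel μ a N K) (hw : IsDriftWeight μ a N w u B)
    (hF : IsFellerWeight μ a N t w) : ConclA μ a N t w := by
  intro k hk
  have hint : ∀ f, MemSob w k f → ∀ x, Integrable f (law μ a N t x) := fun f hf => by
    obtain ⟨-, c, hc, hb, -⟩ := (memSob_iff hw.pos hk).1 hf
    exact hF.integrable_law hf.continuous.measurable hb
  refine ⟨hint, fun f hf => ?_, fun f g hf hg => ?_, fun c f _ => ?_⟩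
  · obtain ⟨hfk, c, hc, hb₀, hb₁⟩ := (memSob_iff hw.pos hk).1 hf
    rw [memSob_iff hw.pos hk]
    have hKB : 0 ≤ l * K ^ t * c * B ^ t := by
      have := pow_nonneg hM.nonneg t
      have := pow_nonneg hw.const_nonneg t
      positivity
    have hcB : 0 ≤ c * B ^ t := mul_nonneg hc (pow_nonneg hw.const_nonneg t)
    have h0 : ∀ x, |P μ a N t f x| ≤ (c * B ^ t + l * K ^ t * c * B ^ t) * w x := fun x => by
      refine (hw.abs_P_le hM hc hb₀ t x).trans ?_
      rw [← mul_assoc]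
      exact mul_le_mul_of_nonneg_right (by linarith) (hw.pos x).le
    interval_cases k
    · refine ⟨?_, _, add_nonneg hcB hKB, h0, by simp⟩
      simpa [contDiff_zero] using hF.continuous_P_of_abs_le hM hf.continuous hb₀
    · have hf1 := contDiff_one_of_memSob hf
      refine ⟨by simpa using hF.contDiff_P hM hf1 hb₀ (hb₁ rfl), _, add_nonneg hcB hKB, h0,
        fun _ i x => (hF.abs_pd_P_le hM hf1 hb₀ (hb₁ rfl) x i).trans ?_⟩
      have hlKc : 0 ≤ l * K ^ t * c := by have := pow_nonneg hM.nonneg t; positivity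
      refine (mul_le_mul_of_nonneg_left (hw.P_le hM t x) hlKc).trans ?_
      rw [← mul_assoc]
      exact mul_le_mul_of_nonneg_right (by linarith) (hw.pos x).le
  · exact funext fun x => integral_add (hint f hf x) (hint g hg x)
  · exact funext fun x => integral_const_mul c f

theorem conclB_of_isFellerWeight (hM : IsSmoothModel μ a N K) (hw : IsDriftWeight μ a N w u B)
    (hF : IsFellerWeight μ a N t w) : ConclB μ a N t w := by
  intro i j
  have hint : ∀ f, MemSob w 0 f → ∀ x,
      Integrable (fun ω => (sens a N t x ω).transpose i j * f (state a N t x ω)) μ := by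
    intro f hf x
    obtain ⟨-, c, hc, hb, -⟩ := (memSob_iff hw.pos zero_le_one).1 hf
    exact hF.integrable_sens_mul hM hf.continuous.measurable hb x j i
  refine ⟨hint, fun f hf => ?_, fun f g hf hg => ?_, fun c f _ => ?_⟩
  · obtain ⟨-, c, hc, hb, -⟩ := (memSob_iff hw.pos zero_le_one).1 hf
    rw [memSob_iff hw.pos zero_le_one]
    have hKc : 0 ≤ K ^ t * c := mul_nonneg (pow_nonneg hM.nonneg t) hc
    refine ⟨by simpa [contDiff_zero] using hF.continuous_Qij hM hf.continuous hb i j,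
      K ^ t * c * B ^ t, mul_nonneg hKc (pow_nonneg hw.const_nonneg t), fun x => ?_, by simp⟩
    refine (hF.abs_Qij_le hM hb i j x).trans ?_
    rw [mul_assoc (K ^ t * c)]
    exact mul_le_mul_of_nonneg_left (hw.P_le hM t x) hKc
  · funext x
    have := integral_add (hint f hf x) (hint g hg x)
    simpa only [Qij, Pi.add_apply, mul_add] using this
  · funext x
    have := integral_const_mul (μ := μ) c
      fun ω => (sens a N t x ω).transpose i j * f (state a N t x ω)
    simpa only [Qij, Pi.smul_apply, smul_eq_mul, mul_left_comm] using this

theorem conclC_of_isFellerWeight (hM : IsSmoothModel μ a N K) (hw : ∀ x, 0 < w x)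
    (hF : IsFellerWeight μ a N t w) : ConclC μ a N t w := by
  intro f hf x
  obtain ⟨-, c, hc, hb₀, hb₁⟩ := (memSob_iff hw le_rfl).1 hf
  exact hF.hasGradientAt_P hM (contDiff_one_of_memSob hf) hb₀ (hb₁ rfl) x

end Drift

/-! ### Products, sums and cutoffs in the weighted norms -/

theorem pd_mul {f g : Rn l → ℝ} {x : Rn l} (hf : DifferentiableAt ℝ f x)
    (hg : DifferentiableAt ℝ g x) (i : Fin l) :
    pd i (fun y => f y * g y) x = f x * pd i g x + g x * pd i f x := by
  simp only [pd]
  rw [fderiv_fun_mul hf hg]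
  simp

theorem pd_add {f g : Rn l → ℝ} {x : Rn l} (hf : DifferentiableAt ℝ f x)
    (hg : DifferentiableAt ℝ g x) (i : Fin l) :
    pd i (fun y => f y + g y) x = pd i f x + pd i g x := by
  simp only [pd]
  rw [fderiv_fun_add hf hg]
  simp

theorem SobBound.mono {w w' f : Rn l → ℝ} {k : ℕ} {c c' : ℝ} (h : SobBound w k c f)
    (hc : ∀ x, c * w x ≤ c' * w' x) : SobBound w' k c' f :=
  ⟨fun x => (h.1 x).trans (hc x), fun hk i x => (h.2 hk i x).trans (hc x)⟩

theorem SobBound.add {w f g : Rn l → ℝ} {k : ℕ} {c c' : ℝ} (hf : SobBound w k c f)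
    (hg : SobBound w k c' g) (hfd : k = 1 → Differentiable ℝ f)
    (hgd : k = 1 → Differentiable ℝ g) : SobBound w k (c + c') fun x => f x + g x := by
  refine ⟨fun x => ?_, fun hk i x => ?_⟩
  · rw [add_mul]
    exact (abs_add_le _ _).trans (add_le_add (hf.1 x) (hg.1 x))
  · rw [add_mul, pd_add (hfd hk x) (hgd hk x)]
    exact (abs_add_le _ _).trans (add_le_add (hf.2 hk i x) (hg.2 hk i x))

/-- Multiplication by a `C¹` function `θ` vanishing outside `S`, of a function bounded on `S`. -/
theorem SobBound.mul_of_bound_on {w f θ : Rn l → ℝ} {k : ℕ} {c M : ℝ} {S : Set (Rn l)}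
    (hw : ∀ x, 0 ≤ w x) (hc : 0 ≤ c) (hM : 0 ≤ M) (hθd : Differentiable ℝ θ)
    (hθ : ∀ x, |θ x| ≤ 1) (hθM : ∀ i x, |pd i θ x| ≤ M) (hS : ∀ x, x ∉ S → θ x = 0)
    (hS' : ∀ i x, x ∉ S → pd i θ x = 0) (hfd : k = 1 → Differentiable ℝ f)
    (hf : ∀ x ∈ S, |f x| ≤ c * w x) (hf' : k = 1 → ∀ i, ∀ x ∈ S, |pd i f x| ≤ c * w x) :
    SobBound w k ((1 + M) * c) fun x => θ x * f x := by
  have hcw : ∀ x, 0 ≤ c * w x := fun x => mul_nonneg hc (hw x)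
  refine ⟨fun x => ?_, fun hk i x => ?_⟩
  · by_cases hx : x ∈ S
    · rw [abs_mul, mul_assoc]
      calc |θ x| * |f x| ≤ 1 * (c * w x) :=
            mul_le_mul (hθ x) (hf x hx) (abs_nonneg _) zero_le_one
        _ ≤ (1 + M) * (c * w x) := mul_le_mul_of_nonneg_right (by linarith) (hcw x)
    · simp only [hS x hx, zero_mul, abs_zero, mul_assoc]
      exact mul_nonneg (by linarith) (hcw x)
  · rw [pd_mul (hθd x) (hfd hk x), mul_assoc]
    by_cases hx : x ∈ S
    · refine (abs_add_le _ _).trans ?_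
      rw [abs_mul, abs_mul, add_mul, mul_comm |f x|]
      exact add_le_add (mul_le_mul (hθ x) (hf' hk i x hx) (abs_nonneg _) zero_le_one)
        (mul_le_mul (hθM i x) (hf x hx) (abs_nonneg _) hM)
    · simp only [hS x hx, hS' i x hx, zero_mul, mul_zero, add_zero, abs_zero]
      exact mul_nonneg (by linarith) (hcw x)

theorem pd_eq_zero_of_notMem_tsupport {f : Rn l → ℝ} {x : Rn l} (hx : x ∉ tsupport f)
    (i : Fin l) : pd i f x = 0 := by
  have h : fderiv ℝ f x = 0 := by
    by_contra h
    exact hx (support_fderiv_subset ℝ (Function.mem_support.2 h))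
  simp [pd, h]

theorem pd_one_sub {f : Rn l → ℝ} (i : Fin l) (x : Rn l) :
    pd i (fun y => 1 - f y) x = -pd i f x := by
  simp only [pd]
  rw [fderiv_const_sub]
  simp

/-- `C¹` cutoff functions of large balls, with a uniform bound on their derivatives. -/
theorem exists_cutoff (l : ℕ) : ∃ M : ℝ, 0 ≤ M ∧ ∀ R : ℝ, 1 ≤ R → ∃ χ : Rn l → ℝ,
    ContDiff ℝ 1 χ ∧ HasCompactSupport χ ∧ (∀ x, 0 ≤ χ x) ∧ (∀ x, χ x ≤ 1) ∧
      (∀ x ∈ Metric.ball (0 : Rn l) R, χ x = 1) ∧ ∀ i x, |pd i χ x| ≤ M := by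
  let φ : ContDiffBump (0 : Rn l) := ⟨1, 2, one_pos, one_lt_two⟩
  have hφ : ContDiff ℝ 1 φ := φ.contDiff
  obtain ⟨C, hC⟩ := hφ.lipschitzWith_of_hasCompactSupport φ.hasCompactSupport (by simp)
  refine ⟨C, C.2, fun R hR => ⟨fun x => φ (R⁻¹ • x), hφ.comp (contDiff_id.const_smul R⁻¹),
    φ.hasCompactSupport.comp_smul (by positivity), fun x => φ.nonneg, fun x => φ.le_one,
    fun x hx => ?_, fun i x => ?_⟩⟩
  · refine φ.one_of_mem_closedBall ?_
    rw [mem_closedBall_zero_iff, norm_smul, norm_inv, Real.norm_of_nonneg (by linarith)]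
    rw [mem_ball_zero_iff] at hx
    exact (inv_mul_le_one₀ (by linarith)).2 hx.le
  -- The cutoff is a fixed bump rescaled by `R⁻¹ ≤ 1`, so its Lipschitz constant is at most that of
  -- the bump, uniformly in `R`.
  · refine (abs_pd_le i x).trans (norm_fderiv_le_of_lipschitz ℝ ?_)
    refine LipschitzWith.of_dist_le_mul fun y z => (hC.dist_le_mul _ _).trans ?_
    rw [dist_smul₀, norm_inv, Real.norm_of_nonneg (by linarith)]
    exact mul_le_mul_of_nonneg_left
      (mul_le_of_le_one_left dist_nonneg (inv_le_one_of_one_le₀ hR)) C.2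

/-! ### Finite-rank operators built from positive measures -/

/-- The operator `f ↦ ∑ i, ν i (f) • s i`. -/
def finiteRankOp {n : ℕ} (s : Fin n → Rn l → ℝ) (ν : Fin n → Measure (Rn l)) (f : Rn l → ℝ) :
    Rn l → ℝ := fun x => ∑ i, s i x * ∫ y, f y ∂ν i

theorem isLinearOpOn_finiteRankOp {w : Rn l → ℝ} (hw : ∀ x, 1 ≤ w x) {k : ℕ} (hk : k ≤ 1) {n : ℕ}
    {s : Fin n → Rn l → ℝ} (hs : ∀ i, ContDiff ℝ 1 (s i)) (hsc : ∀ i, HasCompactSupport (s i))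
    {ν : Fin n → Measure (Rn l)} (hν : ∀ i, Integrable w (ν i)) :
    IsLinearOpOn w k (finiteRankOp s ν) := by
  have hw0 : ∀ x, 0 < w x := fun x => one_pos.trans_le (hw x)
  have hint : ∀ f, MemSob w k f → ∀ i, Integrable f (ν i) := fun f hf i => by
    obtain ⟨-, c, hc, hb, -⟩ := (memSob_iff hw0 hk).1 hf
    exact ((hν i).const_mul c).mono' hf.continuous.aestronglyMeasurable (Eventually.of_forall hb)
  refine ⟨fun f hf => ?_, fun f g hf hg => funext fun x => ?_, fun c f _ => funext fun x => ?_⟩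
  · refine MemSob.of_hasCompactSupport hw
      (ContDiff.sum fun i _ => (hs i).mul contDiff_const) ?_ hk
    have hK : IsCompact (⋃ i, tsupport (s i)) := isCompact_iUnion fun i => hsc i
    refine HasCompactSupport.intro hK fun x hx => Finset.sum_eq_zero fun i _ => ?_
    rw [image_eq_zero_of_notMem_tsupport fun h => hx (Set.mem_iUnion.2 ⟨i, h⟩), zero_mul]
  · simp only [finiteRankOp, Pi.add_apply, ← Finset.sum_add_distrib]
    refine Finset.sum_congr rfl fun i _ => ?_
    rw [integral_add (hint f hf i) (hint g hg i), mul_add]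
  · simp only [finiteRankOp, Pi.smul_apply, smul_eq_mul, Finset.mul_sum]
    refine Finset.sum_congr rfl fun i _ => ?_
    rw [integral_const_mul, mul_left_comm]

theorem isFiniteRank_finiteRankOp {w : Rn l → ℝ} (hw : ∀ x, 1 ≤ w x) {k : ℕ} (hk : k ≤ 1) {n : ℕ}
    {s : Fin n → Rn l → ℝ} (hs : ∀ i, ContDiff ℝ 1 (s i)) (hsc : ∀ i, HasCompactSupport (s i))
    {ν : Fin n → Measure (Rn l)} [∀ i, IsFiniteMeasure (ν i)] (hν : ∀ i, Integrable w (ν i)) :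
    IsFiniteRank w k (finiteRankOp s ν) := by
  refine ⟨n, s, fun i => (ν i).toSignedMeasure, 1,
    fun i => MemSob.of_hasCompactSupport hw (hs i) (hsc i) hk,
    fun i => memMv_toSignedMeasure (fun x => one_pos.trans_le (hw x)) (ν i) (hν i),
    fun f _ x => ?_⟩
  simp only [integral_smul_toSignedMeasure, Matrix.one_apply, ite_mul, one_mul, zero_mul,
    Finset.sum_ite_eq, Finset.mem_univ, if_true, finiteRankOp]

/-! ### Discretization of an integral over a compact set -/

/-- Measurable functions subordinate to a fine finite cover of a compact set, with sum `1`
on the set. -/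
theorem exists_measurable_partition {S : Set (Rn l)} (hS : IsCompact S) {δ : ℝ} (hδ : 0 < δ) :
    ∃ (n : ℕ) (z : Fin n → Rn l) (b : Fin n → Rn l → ℝ), (∀ i, z i ∈ S) ∧
      (∀ i, Measurable (b i)) ∧ (∀ i y, 0 ≤ b i y) ∧ (∀ i y, b i y ≤ 1) ∧
      (∀ y ∈ S, ∑ i, b i y = 1) ∧ ∀ i y, b i y ≠ 0 → dist y (z i) < δ := by
  obtain ⟨T, hTS, hT, hcov⟩ := hS.finite_cover_balls hδ
  have : Finite T := hT
  obtain ⟨n, ⟨e⟩⟩ := Finite.exists_equiv_fin T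
  set B : Fin n → Set (Rn l) := fun i => Metric.ball (e.symm i : Rn l) δ with hB
  have hBm : ∀ i, MeasurableSet (B i) := fun i => Metric.isOpen_ball.measurableSet
  have hBu : S ⊆ ⋃ i, B i := fun y hy => by
    obtain ⟨x, hx, hyx⟩ := Set.mem_iUnion₂.1 (hcov hy)
    exact Set.mem_iUnion.2 ⟨e ⟨x, hx⟩, by simpa [hB] using hyx⟩
  -- The balls of the cover are made disjoint and replaced by indicators. Measurability in `y`
  -- suffices, because these functions will enter only the measures of the finite-rank operator.
  refine ⟨n, fun i => e.symm i, fun i => (disjointed B i).indicator fun _ => 1,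
    fun i => hTS (e.symm i).2, fun i => measurable_const.indicator
      (disjointedRec (p := MeasurableSet) (fun _ j ht => ht.diff (hBm j)) (hBm i)),
    fun i y => Set.indicator_nonneg (fun _ _ => zero_le_one) y,
    fun i y => Set.indicator_le' (fun _ _ => le_rfl) (fun _ _ => zero_le_one) y,
    fun y hy => ?_, fun i y hy => ?_⟩
  · have hy' := hBu hy
    rw [← iUnion_disjointed] at hy'
    obtain ⟨i, hi⟩ := Set.mem_iUnion.1 hy'
    rw [Finset.sum_eq_single i]
    · exact Set.indicator_of_mem hi _
    · exact fun j _ hji => Set.indicator_of_notMem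
        (fun hj => Set.disjoint_left.1 (disjoint_disjointed B hji) hj hi) _
    · simp
  · have h : y ∈ B i := disjointed_subset B i (Set.mem_of_indicator_ne_zero hy)
    exact h

/-- Discretizing the second variable of `κ` in `∫ κ(y) ψ(y) dy`. -/
theorem abs_integral_sub_sum_le {S : Set (Rn l)} {n : ℕ} {z : Fin n → Rn l}
    {b : Fin n → Rn l → ℝ} (hbm : ∀ i, Measurable (b i)) (hb0 : ∀ i y, 0 ≤ b i y)
    (hb1 : ∀ i y, b i y ≤ 1) (hbS : ∀ y ∈ S, ∑ i, b i y = 1) {ψ : Rn l → ℝ}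
    (hψ : Integrable ψ) (hψS : ∀ y, y ∉ S → ψ y = 0) {κ : Rn l → ℝ}
    (hκ : Integrable fun y => κ y * ψ y) {ε : ℝ}
    (hκε : ∀ i, ∀ y ∈ S, b i y ≠ 0 → |κ y - κ (z i)| ≤ ε) :
    |(∫ y, κ y * ψ y) - ∑ i, κ (z i) * ∫ y, b i y * ψ y| ≤ ε * ∫ y, |ψ y| := by
  have hbi : ∀ i, Integrable fun y => b i y * ψ y := fun i =>
    hψ.bdd_mul (hbm i).aestronglyMeasurable (c := 1)
      (Eventually.of_forall fun y => by rw [Real.norm_of_nonneg (hb0 i y)]; exact hb1 i y)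
  simp only [← integral_const_mul]
  have hsum : Integrable fun y => ∑ i, κ (z i) * (b i y * ψ y) :=
    integrable_finsetSum _ fun i _ => (hbi i).const_mul _
  have hsum' : ∑ i, ∫ y, κ (z i) * (b i y * ψ y) = ∫ y, ∑ i, κ (z i) * (b i y * ψ y) :=
    (integral_finsetSum _ fun i _ => (hbi i).const_mul _).symm
  rw [hsum', ← integral_sub hκ hsum]
  refine norm_integral_le_of_norm_le (f := fun y => κ y * ψ y - ∑ i, κ (z i) * (b i y * ψ y))
    (hψ.abs.const_mul ε) (Eventually.of_forall fun y => ?_)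
  by_cases hy : y ∈ S
  · have h1 : κ y * ψ y - ∑ i, κ (z i) * (b i y * ψ y)
        = ∑ i, b i y * (κ y - κ (z i)) * ψ y := by
      calc _ = (∑ i, b i y) * (κ y * ψ y) - ∑ i, κ (z i) * (b i y * ψ y) := by
            rw [hbS y hy, one_mul]
        _ = _ := by
            rw [Finset.sum_mul, ← Finset.sum_sub_distrib]
            exact Finset.sum_congr rfl fun i _ => by ring
    rw [h1, ← Finset.sum_mul, norm_mul, Real.norm_eq_abs, Real.norm_eq_abs]
    refine mul_le_mul_of_nonneg_right ((Finset.abs_sum_le_sum_abs _ _).trans ?_) (abs_nonneg _)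
    calc ∑ i, |b i y * (κ y - κ (z i))| ≤ ∑ i, b i y * ε := by
          refine Finset.sum_le_sum fun i _ => ?_
          rw [abs_mul, abs_of_nonneg (hb0 i y)]
          by_cases h0 : b i y = 0
          · simp [h0]
          · exact mul_le_mul_of_nonneg_left (hκε i y hy h0) (hb0 i y)
      _ = ε := by rw [← Finset.sum_mul, hbS y hy, one_mul]
  · simp [hψS y hy]

theorem hasFDerivAt_comp_prodMk {p : Rn l × Rn l → ℝ} (hp : ContDiff ℝ 1 p) (x y : Rn l) :
    HasFDerivAt (fun x => p (x, y))
      ((fderiv ℝ p (x, y)).comp (ContinuousLinearMap.inl ℝ (Rn l) (Rn l))) x :=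
  HasFDerivAt.comp x (g := p) (f := fun x => (x, y))
    (hp.differentiable (by simp) (x, y)).hasFDerivAt (hasFDerivAt_prodMk_left x y)

/-- Differentiation under the integral sign for a `C¹` kernel and a compactly supported
function. -/
theorem hasFDerivAt_integral_mul {p : Rn l × Rn l → ℝ} (hp : ContDiff ℝ 1 p) {ψ : Rn l → ℝ}
    (hψ : Continuous ψ) (hψs : HasCompactSupport ψ) (x : Rn l) :
    DifferentiableAt ℝ (fun x => ∫ y, p (x, y) * ψ y) x ∧
      ∀ i, pd i (fun x => ∫ y, p (x, y) * ψ y) x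
        = ∫ y, fderiv ℝ p (x, y) (EuclideanSpace.single i 1, 0) * ψ y := by
  have hpc := hp.continuous
  have hfd : Continuous (fderiv ℝ p) := hp.continuous_fderiv (by simp)
  set F' : Rn l → Rn l → Rn l →L[ℝ] ℝ := fun x y =>
    ψ y • (fderiv ℝ p (x, y)).comp (ContinuousLinearMap.inl ℝ (Rn l) (Rn l)) with hF'
  have hF'c : Continuous fun z : Rn l × Rn l => F' z.1 z.2 :=
    (hψ.comp continuous_snd).smul (hfd.clm_comp continuous_const)
  obtain ⟨C, hC⟩ := ((isCompact_closedBall x 1).prod hψs).exists_bound_of_continuousOn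
    hF'c.continuousOn
  have hint : ∀ {E : Type} [NormedAddCommGroup E] {g : Rn l → E}, Continuous g →
      (∀ y, y ∉ tsupport ψ → g y = 0) → Integrable g := fun hg h0 =>
    hg.integrable_of_hasCompactSupport (HasCompactSupport.intro hψs h0)
  have hψ0 : ∀ y, y ∉ tsupport ψ → ψ y = 0 := fun y hy => image_eq_zero_of_notMem_tsupport hy
  have hFi : ∀ x, Integrable fun y => p (x, y) * ψ y := fun x =>
    hint ((hpc.comp (continuous_const.prodMk continuous_id)).mul hψ) fun y hy => by simp [hψ0 y hy]
  have hF'i : ∀ x, Integrable (F' x) := fun x =>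
    (hF'c.comp (continuous_const.prodMk continuous_id)).integrable_of_hasCompactSupport
      (HasCompactSupport.intro hψs fun y hy => by simp [hF', hψ0 y hy])
  have key := hasFDerivAt_integral_of_dominated_of_fderiv_le (μ := volume)
    (F := fun x y => p (x, y) * ψ y) (F' := F') (bound := (tsupport ψ).indicator fun _ => C)
    (Metric.closedBall_mem_nhds x one_pos)
    (Eventually.of_forall fun x => (hFi x).aestronglyMeasurable) (hFi x)
    (hF'i x).aestronglyMeasurable
    (Eventually.of_forall fun y x' hx' => by
      by_cases hy : y ∈ tsupport ψ
      · rw [Set.indicator_of_mem hy]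
        exact hC (x', y) ⟨hx', hy⟩
      · simp [hF', hψ0 y hy, hy])
    ((integrable_indicator_iff hψs.measurableSet).2 (integrableOn_const hψs.measure_lt_top.ne))
    (Eventually.of_forall fun y x' _ => (hasFDerivAt_comp_prodMk hp x' y).mul_const (ψ y))
  refine ⟨key.differentiableAt, fun i => ?_⟩
  rw [pd, key.fderiv, ContinuousLinearMap.integral_apply (hF'i x)]
  refine integral_congr_ae (Eventually.of_forall fun y => ?_)
  simp [hF', mul_comm]

/-! ### Separability -/

section Separability

variable {μ : Measure Ω} {a : Rn l → Rn m → Rn l} {N : ℕ → Ω → Rn m}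
  {K : ℝ} {t : ℕ} {w u : Rn l → ℝ} {B : ℝ}

/-- Discretization of the density of `P^t` over a compact set, together with its first
derivatives. -/
theorem IsC1Density.exists_discretization {p : Rn l × Rn l → ℝ} (hp : IsC1Density μ a N t p)
    {S : Set (Rn l)} (hS : IsCompact S) {ε : ℝ} (hε : 0 < ε) :
    ∃ (n : ℕ) (z : Fin n → Rn l) (b : Fin n → Rn l → ℝ), (∀ i, Measurable (b i)) ∧
      (∀ i y, 0 ≤ b i y) ∧ (∀ i y, b i y ≤ 1) ∧
      ∀ ψ : Rn l → ℝ, Continuous ψ → (∀ y, y ∉ S → ψ y = 0) →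
        Differentiable ℝ (fun x => P μ a N t ψ x - ∑ i, p (x, z i) * ∫ y, b i y * ψ y) ∧
        (∀ x ∈ S, |P μ a N t ψ x - ∑ i, p (x, z i) * ∫ y, b i y * ψ y| ≤ ε * ∫ y, |ψ y|) ∧
        ∀ j, ∀ x ∈ S, |pd j (fun x => P μ a N t ψ x - ∑ i, p (x, z i) * ∫ y, b i y * ψ y) x|
          ≤ ε * ∫ y, |ψ y| := by
  have hpC := hp.contDiff
  have hpc := hpC.continuous
  have hfd : Continuous (fderiv ℝ p) := hpC.continuous_fderiv (by simp)
  -- Uniform continuity of the pair formed by `p` and its derivative yields one mesh `δ` that serves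
  -- both the value and the gradient estimates.
  have huc := (hS.prod hS).uniformContinuousOn_of_continuous (hpc.prodMk hfd).continuousOn
  obtain ⟨δ, hδ, huδ⟩ := Metric.uniformContinuousOn_iff.1 huc ε hε
  obtain ⟨n, z, b, hzS, hbm, hb0, hb1, hbS, hbδ⟩ := exists_measurable_partition hS hδ
  have hclose : ∀ x ∈ S, ∀ i, ∀ y ∈ S, b i y ≠ 0 →
      |p (x, y) - p (x, z i)| ≤ ε ∧ ‖fderiv ℝ p (x, y) - fderiv ℝ p (x, z i)‖ ≤ ε := by
    intro x hx i y hy hb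
    have h := (huδ (x, y) ⟨hx, hy⟩ (x, z i) ⟨hx, hzS i⟩ (by
      rw [Prod.dist_eq, dist_self, max_eq_right dist_nonneg]
      exact hbδ i y hb)).le
    rw [Prod.dist_eq, max_le_iff, Real.dist_eq, dist_eq_norm] at h
    exact h
  refine ⟨n, z, b, hbm, hb0, hb1, fun ψ hψ hψS => ?_⟩
  have hψs : HasCompactSupport ψ := HasCompactSupport.intro hS hψS
  have hψi : Integrable ψ := hψ.integrable_of_hasCompactSupport hψs
  have hP : P μ a N t ψ = fun x => ∫ y, p (x, y) * ψ y := funext (hp.P_eq ψ)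
  have hder := fun x => hasFDerivAt_integral_mul hpC hψ hψs x
  set c : Fin n → ℝ := fun i => ∫ y, b i y * ψ y with hc
  have hsum : ∀ x, HasFDerivAt (fun x => ∑ i, p (x, z i) * c i) (∑ i, c i •
      (fderiv ℝ p (x, z i)).comp (ContinuousLinearMap.inl ℝ (Rn l) (Rn l))) x := fun x =>
    HasFDerivAt.fun_sum fun i _ => (hasFDerivAt_comp_prodMk hpC x (z i)).mul_const (c i)
  have hint : ∀ {κ : Rn l → ℝ}, Continuous κ → Integrable fun y => κ y * ψ y := fun hκ =>
    (hκ.mul hψ).integrable_of_hasCompactSupport hψs.mul_left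
  rw [hP]
  refine ⟨fun x => (hder x).1.sub (hsum x).differentiableAt, fun x hx => ?_, fun j x hx => ?_⟩
  · exact abs_integral_sub_sum_le hbm hb0 hb1 hbS hψi hψS (κ := fun y => p (x, y))
      (hint (hpc.comp (continuous_const.prodMk continuous_id)))
      fun i y hy hb => (hclose x hx i y hy hb).1
  · have hpd : pd j (fun x => (∫ y, p (x, y) * ψ y) - ∑ i, p (x, z i) * c i) x
        = (∫ y, fderiv ℝ p (x, y) (EuclideanSpace.single j 1, 0) * ψ y)
          - ∑ i, fderiv ℝ p (x, z i) (EuclideanSpace.single j 1, 0) * c i := by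
      rw [← (hder x).2 j, pd, pd, fderiv_fun_sub (hder x).1 (hsum x).differentiableAt,
        (hsum x).fderiv]
      simp [mul_comm]
    rw [hpd]
    refine abs_integral_sub_sum_le hbm hb0 hb1 hbS hψi hψS
      (κ := fun y => fderiv ℝ p (x, y) (EuclideanSpace.single j 1, 0))
      (hint ((hfd.comp (continuous_const.prodMk continuous_id)).clm_apply continuous_const))
      fun i y hy hb => ?_
    have h := ((fderiv ℝ p (x, y) - fderiv ℝ p (x, z i)).le_of_opNorm_le
      (hclose x hx i y hy hb).2 (EuclideanSpace.single j 1, 0))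
    simpa [Prod.norm_def] using h

/-- A `C¹` cutoff equal to `1` wherever the decay factor `u` exceeds `ε`. -/
theorem IsDriftWeight.exists_cutoff_decay (hw : IsDriftWeight μ a N w u B) {M : ℝ}
    (hcut : ∀ R : ℝ, 1 ≤ R → ∃ χ : Rn l → ℝ, ContDiff ℝ 1 χ ∧ HasCompactSupport χ ∧
      (∀ x, 0 ≤ χ x) ∧ (∀ x, χ x ≤ 1) ∧ (∀ x ∈ Metric.ball (0 : Rn l) R, χ x = 1) ∧
      ∀ i x, |pd i χ x| ≤ M) {ε : ℝ} (hε : 0 < ε) :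
    ∃ (χ : Rn l → ℝ) (A : Set (Rn l)), ContDiff ℝ 1 χ ∧ HasCompactSupport χ ∧ (∀ x, 0 ≤ χ x) ∧
      (∀ x, χ x ≤ 1) ∧ (∀ i x, |pd i χ x| ≤ M) ∧ (∀ x, x ∉ A → χ x = 1) ∧
      (∀ i x, x ∉ A → pd i χ x = 0) ∧ ∀ x ∈ A, u x ≤ ε := by
  obtain ⟨S, hS, hSu⟩ := mem_cocompact.1 (hw.tendsto_decay.eventually (gt_mem_nhds hε))
  obtain ⟨R, hR1, hSR⟩ : ∃ R, 1 ≤ R ∧ S ⊆ Metric.ball (0 : Rn l) R := by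
    obtain ⟨R, hR⟩ := hS.isBounded.subset_ball (0 : Rn l)
    exact ⟨max R 1, le_max_right _ _, hR.trans (Metric.ball_subset_ball (le_max_left _ _))⟩
  obtain ⟨χ, hχ, hχs, h0, h1, hball, hM⟩ := hcut R hR1
  refine ⟨χ, (Metric.ball 0 R)ᶜ, hχ, hχs, h0, h1, hM, fun x hx => hball x (not_not.1 hx),
    fun i x hx => ?_, fun x hx => ?_⟩
  · have heq : χ =ᶠ[𝓝 x] fun _ => 1 :=
      Filter.eventually_of_mem (Metric.isOpen_ball.mem_nhds (not_not.1 hx)) hball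
    rw [pd, heq.fderiv_eq]
    simp
  · exact (hSu fun hxS => hx (hSR hxS) : u x < ε).le

variable [IsProbabilityMeasure μ]

/-- The factor `l K^t` bounds the `l` terms of a component of `Q^t ∇f`; the added `1` covers `P^t f`
itself. -/
theorem IsFellerWeight.sobBound_P (hM : IsSmoothModel μ a N K) (hw : IsFellerWeight μ a N t w)
    {k : ℕ} (hk : k ≤ 1) {f : Rn l → ℝ} (hf : ContDiff ℝ k f) {c : ℝ} (hc : 0 ≤ c)
    (hb : SobBound w k c f) (hw0 : ∀ x, 0 ≤ w x) :
    SobBound (P μ a N t w) k ((1 + l * K ^ t) * c) (P μ a N t f) ∧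
      ContDiff ℝ k (P μ a N t f) := by
  have hKt := pow_nonneg hM.nonneg t
  have hPw : ∀ x, 0 ≤ P μ a N t w x := fun x => integral_nonneg hw0
  have h0 : ∀ x, |P μ a N t f x| ≤ (1 + l * K ^ t) * c * P μ a N t w x := fun x => by
    refine (hw.abs_P_le hb.1 x).trans (mul_le_mul_of_nonneg_right ?_ (hPw x))
    exact le_mul_of_one_le_left hc (by linarith [mul_nonneg (Nat.cast_nonneg (α := ℝ) l) hKt])
  interval_cases k
  · exact ⟨⟨h0, by simp⟩,
      by simpa [contDiff_zero] using hw.continuous_P_of_abs_le hM hf.continuous hb.1⟩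
  · have hf1 : ContDiff ℝ 1 f := by simpa using hf
    refine ⟨⟨h0, fun _ i x => (hw.abs_pd_P_le hM hf1 hb.1 (hb.2 rfl) x i).trans ?_⟩,
      by simpa using hw.contDiff_P hM hf1 hb.1 (hb.2 rfl)⟩
    refine mul_le_mul_of_nonneg_right (mul_le_mul_of_nonneg_right ?_ hc) (hPw x)
    linarith

namespace IsDriftWeight

/-- The measure `∫ ψ(y) P^s(y, ·) dy`. -/
theorem bind_law_withDensity (hM : IsSmoothModel μ a N K) (hw : IsDriftWeight μ a N w u B)
    (s : ℕ) {ψ : Rn l → ℝ} (hψm : Measurable ψ) (hψ0 : ∀ y, 0 ≤ ψ y)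
    (hψ : Integrable fun y => ψ y * w y) :
    IsFiniteMeasure ((volume.withDensity fun y => ENNReal.ofReal (ψ y)).bind (law μ a N s)) ∧
    Integrable w ((volume.withDensity fun y => ENNReal.ofReal (ψ y)).bind (law μ a N s)) ∧
    ∀ f : Rn l → ℝ, Measurable f → ∀ c, (∀ x, |f x| ≤ c * w x) →
      ∫ x, f x ∂(volume.withDensity fun y => ENNReal.ofReal (ψ y)).bind (law μ a N s)
        = ∫ y, ψ y * P μ a N s f y := by
  set ν₀ : Measure (Rn l) := volume.withDensity fun y => ENNReal.ofReal (ψ y) with hν₀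
  have hlm := (measurable_law (μ := μ) hM.continuous hM.iid.meas s).aemeasurable (μ := ν₀)
  have hprob := isProbabilityMeasure_law (μ := μ) hM.continuous hM.iid.meas s
  have hψi : Integrable ψ := hψ.mono' hψm.aestronglyMeasurable <| Eventually.of_forall fun y => by
    rw [Real.norm_of_nonneg (hψ0 y)]
    exact le_mul_of_one_le_right (hψ0 y) (hw.one_le y)
  have hfin₀ : IsFiniteMeasure ν₀ := isFiniteMeasure_withDensity_ofReal hψi.2
  have hfin : IsFiniteMeasure (ν₀.bind (law μ a N s)) := ⟨by
    rw [Measure.bind_apply .univ hlm]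
    simp⟩
  have hwi : Integrable w (ν₀.bind (law μ a N s)) := by
    refine ⟨hw.continuous.aestronglyMeasurable, ?_⟩
    have hw0 : ∀ x, 0 ≤ w x := fun x => (hw.pos x).le
    have hm : Measurable fun y => ∫⁻ z, ENNReal.ofReal (w z) ∂(law μ a N s y) :=
      hw.continuous.measurable.ennreal_ofReal.lintegral_kernel
        (κ := lawKernel μ hM.continuous hM.iid.meas s)
    rw [hasFiniteIntegral_iff_ofReal (Eventually.of_forall hw0),
      Measure.lintegral_bind hlm hw.continuous.measurable.ennreal_ofReal.aemeasurable, hν₀,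
      lintegral_withDensity_eq_lintegral_mul _ hψm.ennreal_ofReal hm]
    have hψB : Integrable fun y => ψ y * (B ^ s * w y) := by
      simpa only [mul_left_comm] using hψ.const_mul (B ^ s)
    have hψB0 : ∀ y, 0 ≤ ψ y * (B ^ s * w y) := fun y =>
      mul_nonneg (hψ0 y) (mul_nonneg (pow_nonneg hw.const_nonneg s) (hw0 y))
    refine lt_of_le_of_lt (lintegral_mono fun y => ?_)
      ((hasFiniteIntegral_iff_ofReal (Eventually.of_forall hψB0)).1 hψB.2)
    rw [Pi.mul_apply, ENNReal.ofReal_mul (hψ0 y)]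
    gcongr
    rw [← ofReal_integral_eq_lintegral_ofReal (hw.integrable hM s y) (Eventually.of_forall hw0)]
    exact ENNReal.ofReal_le_ofReal (hw.P_le hM s y)
  refine ⟨hfin, hwi, fun f hf c hc => ?_⟩
  have hfi : Integrable f (ν₀.bind (law μ a N s)) :=
    (hwi.const_mul c).mono' hf.aestronglyMeasurable (Eventually.of_forall hc)
  have h := ProbabilityTheory.Kernel.integral_comp (κ := Kernel.const Unit ν₀)
    (η := lawKernel μ hM.continuous hM.iid.meas s) (a := ()) (f := f) hfi
  have h' : ∫ x, f x ∂ν₀.bind (law μ a N s) = ∫ y, P μ a N s f y ∂ν₀ := h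
  rw [h', hν₀, integral_withDensity_eq_integral_toReal_smul hψm.ennreal_ofReal
    (Eventually.of_forall fun y => ENNReal.ofReal_lt_top)]
  simp only [ENNReal.toReal_ofReal (hψ0 _), smul_eq_mul]

/-- Decay of `P^t f` in the weighted norms, for `t ≥ 1`. -/
theorem sobBound_P_decay (hM : IsSmoothModel μ a N K) (hw : IsDriftWeight μ a N w u B)
    (hF : IsFellerWeight μ a N t w) (ht : 1 ≤ t) {k : ℕ} (hk : k ≤ 1) {f : Rn l → ℝ}
    (hf : ContDiff ℝ k f) {c : ℝ} (hc : 0 ≤ c) (hb : SobBound w k c f) :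
    SobBound (fun x => u x * w x) k ((1 + l * K ^ t) * B ^ t * c) (P μ a N t f) ∧
      ContDiff ℝ k (P μ a N t f) := by
  have h := hF.sobBound_P hM hk hf hc hb fun x => (hw.pos x).le
  refine ⟨h.1.mono fun x => ?_, h.2⟩
  have hL : 0 ≤ (1 + l * K ^ t) * c := by
    have := pow_nonneg hM.nonneg t
    positivity
  calc _ ≤ (1 + l * K ^ t) * c * (B ^ t * (u x * w x)) :=
        mul_le_mul_of_nonneg_left (hw.P_le_decay hM ht x) hL
    _ = _ := by ring

/-- `P^t f` is small in the weighted norms if `f` is small relative to `w`. -/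
theorem sobBound_P_of_small (hM : IsSmoothModel μ a N K) (hw : IsDriftWeight μ a N w u B)
    {ε : ℝ} (hε : 0 ≤ ε) {k : ℕ} (hk : k ≤ 1) {f : Rn l → ℝ}
    (hf : ContDiff ℝ k f) {c : ℝ} (hc : 0 ≤ c)
    (hb : SobBound (fun x => min (u x) ε * w x) k c f) (t : ℕ) :
    SobBound w k ((1 + l * K ^ t) * B ^ t * ε * c) (P μ a N t f) ∧
      ContDiff ℝ k (P μ a N t f) ∧ ∀ x, Integrable f (law μ a N t x) := by
  have hρ0 : ∀ x, 0 ≤ min (u x) ε := fun x => le_min (hw.decay_nonneg x) hε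
  -- The minimum keeps both properties: `u` makes the weight negligible against `w`, hence Feller at
  -- every time, while `ε` supplies the smallness. This matters at `t = t₀`, where `w` itself is not
  -- known to be a Feller weight.
  have hF := hw.isFellerWeight_of_negligible hM t (ρ := fun x => min (u x) ε)
    (hw.continuous_decay.min continuous_const)
    (squeeze_zero hρ0 (fun x => min_le_left _ _) hw.tendsto_decay) hρ0
    fun x => (min_le_left _ _).trans (hw.decay_le_one x)
  have h := hF.sobBound_P hM hk hf hc hb fun x => mul_nonneg (hρ0 x) (hw.pos x).le
  refine ⟨h.1.mono fun x => ?_, h.2, hF.integrable_law hf.continuous.measurable hb.1⟩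
  have hL : 0 ≤ (1 + l * K ^ t) * c := by
    have := pow_nonneg hM.nonneg t
    positivity
  have hP : P μ a N t (fun x => min (u x) ε * w x) x ≤ ε * (B ^ t * w x) := by
    refine (P_mono (hF.integrable x) ((hw.integrable hM t x).const_mul ε) fun y =>
      mul_le_mul_of_nonneg_right (min_le_right _ _) (hw.pos y).le).trans ?_
    rw [P_const_mul]
    exact mul_le_mul_of_nonneg_left (hw.P_le hM t x) hε
  calc _ ≤ (1 + l * K ^ t) * c * (ε * (B ^ t * w x)) := mul_le_mul_of_nonneg_left hP hL
    _ = _ := by ring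

/-- The time is split as `t₀ + s`: the factor `P^{t₀}` provides the kernel to discretize, and `s ≥
t₀ + 1` makes `P^s` act on the weighted spaces with decay. With `χ` cutting off in both variables,
the approximating operator has functions `χ p(·, z i)` and measures `∫ b i(y) χ(y) P^s(y, ·) dy`. -/
theorem conclD (hM : IsSmoothModel μ a N K) (hw : IsDriftWeight μ a N w u B) {t₀ : ℕ}
    {p : Rn l × Rn l → ℝ} (hp : IsC1Density μ a N t₀ p) (ht : 2 * t₀ + 1 ≤ t) :
    ConclD μ a N t w := by
  obtain ⟨s, hs, rfl⟩ : ∃ s, t₀ + 1 ≤ s ∧ t = t₀ + s := ⟨t - t₀, by omega, by omega⟩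
  intro k hk
  have hFt : IsFellerWeight μ a N (t₀ + s) w := hw.isFellerWeight hM hp (by omega)
  have hFs : IsFellerWeight μ a N s w := hw.isFellerWeight hM hp hs
  have hw0 : ∀ x, 0 ≤ w x := fun x => (hw.pos x).le
  refine ⟨(conclA_of_isFellerWeight hM hw hFt k hk).2, fun ε hε => ?_⟩
  have hC : ∀ j, 0 ≤ (1 + l * K ^ j) * B ^ j := fun j => by
    have := pow_nonneg hM.nonneg j
    have := pow_nonneg hw.const_nonneg j
    positivity
  obtain ⟨C₁, hC₁⟩ : ∃ C, C = (1 + l * K ^ s) * B ^ s := ⟨_, rfl⟩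
  obtain ⟨C₂, hC₂⟩ : ∃ C, C = (1 + l * K ^ (t₀ + s)) * B ^ (t₀ + s) := ⟨_, rfl⟩
  obtain ⟨C₃, hC₃⟩ : ∃ C, C = (1 + l * K ^ t₀) * B ^ t₀ := ⟨_, rfl⟩
  have hC₁0 : 0 ≤ C₁ := hC₁ ▸ hC s
  have hC₂0 : 0 ≤ C₂ := hC₂ ▸ hC (t₀ + s)
  have hC₃0 : 0 ≤ C₃ := hC₃ ▸ hC t₀
  obtain ⟨M, hM0, hcut⟩ := exists_cutoff l
  -- `D` collects the factors multiplying `ε₁` in the two tail terms. It can be fixed before the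
  -- cutoff because `M` does not depend on the radius.
  obtain ⟨D, hD⟩ : ∃ D, D = (1 + M) * C₂ + (1 + M) * (C₃ * ((1 + M) * C₁)) := ⟨_, rfl⟩
  have hD0 : 0 ≤ D := by rw [hD]; positivity
  obtain ⟨ε₁, hε₁⟩ : ∃ e, e = ε / (2 * (D + 1)) := ⟨_, rfl⟩
  have hε₁0 : 0 < ε₁ := by rw [hε₁]; positivity
  obtain ⟨χ, A, hχ, hχs, hχ0, hχ1, hχM, hχA, hχA', hAu⟩ := hw.exists_cutoff_decay hcut hε₁0
  have hχc := hχ.continuous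
  have hχd : Differentiable ℝ χ := hχ.differentiable (by simp)
  -- `J` depends on the cutoff, so the discretization accuracy `ε₂` is chosen only now. The two
  -- errors contribute `ε / 2` each, and the `+ 1` keeps the denominators positive.
  obtain ⟨J, hJ⟩ : ∃ J, J = ∫ y, χ y * w y := ⟨_, rfl⟩
  have hJ0 : 0 ≤ J := by rw [hJ]; exact integral_nonneg fun y => mul_nonneg (hχ0 y) (hw0 y)
  obtain ⟨ε₂, hε₂⟩ : ∃ e, e = ε / (2 * ((1 + M) * (C₁ * J) + 1)) := ⟨_, rfl⟩
  have hε₂0 : 0 < ε₂ := by rw [hε₂]; positivity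
  obtain ⟨n, z, b, hbm, hb0, hb1, hdisc⟩ := hp.exists_discretization hχs hε₂0
  have hχw : Integrable fun y => χ y * w y :=
    (hχc.mul hw.continuous).integrable_of_hasCompactSupport hχs.mul_right
  have hν := fun i => hw.bind_law_withDensity hM s (ψ := fun y => b i y * χ y)
    ((hbm i).mul hχc.measurable) (fun y => mul_nonneg (hb0 i y) (hχ0 y)) (by
      simp only [mul_assoc]
      exact hχw.bdd_mul (hbm i).aestronglyMeasurable (c := 1) (Eventually.of_forall fun y => by
        rw [Real.norm_of_nonneg (hb0 i y)]; exact hb1 i y))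
  set ν : Fin n → Measure (Rn l) := fun i =>
    (volume.withDensity fun y => ENNReal.ofReal (b i y * χ y)).bind (law μ a N s) with hνdef
  have hνfin : ∀ i, IsFiniteMeasure (ν i) := fun i => (hν i).1
  set σ : Fin n → Rn l → ℝ := fun i x => χ x * p (x, z i) with hσdef
  have hσ : ∀ i, ContDiff ℝ 1 (σ i) := fun i =>
    hχ.mul (hp.contDiff.comp (contDiff_id.prodMk contDiff_const))
  have hσs : ∀ i, HasCompactSupport (σ i) := fun i => hχs.mul_right
  refine ⟨finiteRankOp σ ν,
    isLinearOpOn_finiteRankOp hw.one_le hk hσ hσs fun i => (hν i).2.1,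
    isFiniteRank_finiteRankOp hw.one_le hk hσ hσs fun i => (hν i).2.1,
    opNorm_le_ofReal hw.pos hk hε.le fun f c hc hf hfb => ?_⟩
  have hdiff : ∀ {g : Rn l → ℝ}, ContDiff ℝ k g → k = 1 → Differentiable ℝ g := by
    rintro g hg rfl
    exact hg.differentiable (by simp)
  obtain ⟨hF, hFk⟩ := hw.sobBound_P_decay hM hFt (by omega) hk hf.1 hc hfb
  obtain ⟨hg, hgk⟩ := hw.sobBound_P_decay hM hFs (by omega) hk hf.1 hc hfb
  rw [← hC₂] at hF
  rw [← hC₁] at hg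
  set g : Rn l → ℝ := P μ a N s f with hgdef
  -- away from the support of the cutoff, the decay factor is small
  have hcutoff : ∀ {h : Rn l → ℝ} {C : ℝ}, 0 ≤ C → SobBound (fun x => u x * w x) k C h →
      ContDiff ℝ k h →
      SobBound (fun x => min (u x) ε₁ * w x) k ((1 + M) * C) fun x => (1 - χ x) * h x := by
    intro h C hC hh hhk
    have hmin : ∀ x ∈ A, min (u x) ε₁ = u x := fun x hx => min_eq_left (hAu x hx)
    refine SobBound.mul_of_bound_on (S := A)
      (fun x => mul_nonneg (le_min (hw.decay_nonneg x) hε₁0.le) (hw0 x)) hC hM0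
      (hχd.const_sub 1) (fun x => abs_le.2 ⟨by linarith [hχ1 x], by linarith [hχ0 x]⟩)
      (fun i x => ?_) (fun x hx => by rw [hχA x hx, sub_self]) (fun i x hx => ?_) (hdiff hhk)
      (fun x hx => by rw [hmin x hx]; exact hh.1 x)
      fun h1 i x hx => by rw [hmin x hx]; exact hh.2 h1 i x
    · rw [pd_one_sub, abs_neg]
      exact hχM i x
    · rw [pd_one_sub, hχA' i x hx, neg_zero]
  have hone_sub : ContDiff ℝ k fun x => 1 - χ x := contDiff_of_le_one (contDiff_const.sub hχ) hk
  have hC₁c : 0 ≤ C₁ * c := mul_nonneg hC₁0 hc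
  have hC₂c : 0 ≤ C₂ * c := mul_nonneg hC₂0 hc
  -- First tail term: `(1-χ) P^t f`, small because `u ≤ ε₁` wherever `1-χ` does not vanish.
  have hterm₁ := (hcutoff hC₂c hF hFk).mono (w' := w) (c' := (1 + M) * (C₂ * c) * ε₁) fun x => by
    rw [mul_assoc _ ε₁]
    exact mul_le_mul_of_nonneg_left
      (mul_le_mul_of_nonneg_right (min_le_right _ _) (hw0 x)) (by positivity)
  -- Second tail term: `P^{t₀}` applied to `(1-χ) P^s f`, which is already small relative to `w`.
  obtain ⟨hterm₂, hterm₂k, hterm₂i⟩ := hw.sobBound_P_of_small hM hε₁0.le hk (hone_sub.mul hgk)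
    (by positivity) (hcutoff hC₁c hg hgk) t₀
  rw [← hC₃] at hterm₂
  have hgc : Continuous g := hgk.continuous
  set ψ : Rn l → ℝ := fun y => χ y * g y with hψdef
  have hψc : Continuous ψ := hχc.mul hgc
  have hψs : HasCompactSupport ψ := hχs.mul_right
  obtain ⟨hEd, hE0, hE1⟩ := hdisc ψ hψc fun y hy => by
    simp only [hψdef]
    rw [image_eq_zero_of_notMem_tsupport hy, zero_mul]
  set E : Rn l → ℝ := fun x => P μ a N t₀ ψ x - ∑ i, p (x, z i) * ∫ y, b i y * ψ y with hEdef
  have hψint : ∫ y, |ψ y| ≤ C₁ * J * c := by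
    calc ∫ y, |ψ y| ≤ ∫ y, C₁ * c * (χ y * w y) := by
          refine integral_mono (hψc.integrable_of_hasCompactSupport hψs).abs
            (hχw.const_mul _) fun y => ?_
          simp only [hψdef]
          rw [abs_mul, abs_of_nonneg (hχ0 y), mul_left_comm]
          refine mul_le_mul_of_nonneg_left ((hg.1 y).trans ?_) (hχ0 y)
          exact mul_le_mul_of_nonneg_left (hw.decay_mul_le y) hC₁c
      _ = C₁ * J * c := by rw [integral_const_mul, hJ]; ring
  -- The discretization error is bounded by a constant, and `w ≥ 1` converts it into a weighted
  -- bound.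
  have hEw : ∀ x, ε₂ * ∫ y, |ψ y| ≤ ε₂ * (C₁ * J * c) * w x := fun x =>
    (mul_le_mul_of_nonneg_left hψint hε₂0.le).trans
      (le_mul_of_one_le_right (by positivity) (hw.one_le x))
  -- the error inside the cutoff
  have hterm₃ : SobBound w k ((1 + M) * (C₃ * ε₁ * ((1 + M) * (C₁ * c)) + ε₂ * (C₁ * J * c)))
      fun x => χ x * (P μ a N t₀ (fun y => (1 - χ y) * g y) x + E x) := by
    have hd : k = 1 → Differentiable ℝ (P μ a N t₀ fun y => (1 - χ y) * g y) := hdiff hterm₂k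
    refine SobBound.mul_of_bound_on (S := tsupport χ) hw0 (by positivity) hM0 hχd
      (fun x => by rw [abs_of_nonneg (hχ0 x)]; exact hχ1 x) hχM
      (fun x hx => image_eq_zero_of_notMem_tsupport hx)
      (fun i x hx => pd_eq_zero_of_notMem_tsupport hx i) (fun h1 => (hd h1).add hEd)
      (fun x hx => ?_) fun h1 i x hx => ?_
    · rw [add_mul]
      exact (abs_add_le _ _).trans (add_le_add (hterm₂.1 x) ((hE0 x hx).trans (hEw x)))
    · rw [add_mul, pd_add (hd h1 x) (hEd x)]
      exact (abs_add_le _ _).trans (add_le_add (hterm₂.2 h1 i x) ((hE1 i x hx).trans (hEw x)))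
  have hdecomp : P μ a N (t₀ + s) f - finiteRankOp σ ν f = fun x =>
      (1 - χ x) * P μ a N (t₀ + s) f x
        + χ x * (P μ a N t₀ (fun y => (1 - χ y) * g y) x + E x) := by
    funext x
    have hψi : Integrable ψ (law μ a N t₀ x) := by
      have := isProbabilityMeasure_law (μ := μ) hM.continuous hM.iid.meas t₀ x
      exact hψc.integrable_of_hasCompactSupport hψs
    have h1 : P μ a N (t₀ + s) f x
        = P μ a N t₀ (fun y => (1 - χ y) * g y) x + P μ a N t₀ ψ x := by
      rw [P_add hM.continuous hM.iid t₀ s x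
        (hFt.integrable_law hf.continuous.measurable hfb.1 x)]
      have h := integral_add (hterm₂i x) hψi
      refine Eq.trans (integral_congr_ae (Eventually.of_forall fun y => ?_)) h
      simp only [hψdef]
      ring
    have h2 : finiteRankOp σ ν f x = χ x * ∑ i, p (x, z i) * ∫ y, b i y * ψ y := by
      rw [finiteRankOp, Finset.mul_sum]
      refine Finset.sum_congr rfl fun i _ => ?_
      rw [(hν i).2.2 f hf.continuous.measurable c hfb.1]
      simp only [hσdef, hψdef, mul_assoc, hgdef]
    simp only [hEdef]
    rw [Pi.sub_apply, h2, h1]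
    ring
  rw [hdecomp]
  refine (hterm₁.add hterm₃ (fun h1 => ?_) fun h1 => ?_).mono fun x =>
    mul_le_mul_of_nonneg_right ?_ (hw0 x)
  · exact (hχd.const_sub 1).mul (hdiff hFk h1)
  · exact hχd.mul ((hdiff hterm₂k h1).add hEd)
  · have e₁ : D * ε₁ ≤ ε / 2 := by
      rw [hε₁, mul_div_assoc', div_le_div_iff₀ (by positivity) two_pos]
      nlinarith
    have e₂ : (1 + M) * (C₁ * J) * ε₂ ≤ ε / 2 := by
      have : 0 ≤ (1 + M) * (C₁ * J) := by positivity
      rw [hε₂, mul_div_assoc', div_le_div_iff₀ (by positivity) two_pos]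
      nlinarith
    calc _ = (D * ε₁ + (1 + M) * (C₁ * J) * ε₂) * c := by rw [hD]; ring
      _ ≤ ε * c := mul_le_mul_of_nonneg_right (by linarith) hc

end IsDriftWeight

end Separability

end WeightedSobolev

end

/-! ### Assembly for the weights `v^η` -/

open WeightedSobolev in
theorem theorem3p7 {l m : ℕ} {Ω : Type*} [MeasurableSpace Ω]
    (μ : Measure Ω) [IsProbabilityMeasure μ]
    (N : ℕ → Ω → Rn m) (hN : IsIID μ N)
    (a : Rn l → Rn m → Rn l) (ha : Continuous fun z : Rn l × Rn m => a z.1 z.2)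
    (V : Rn l → ℝ)
    (h1 : A1 a) (h2 : A2 μ a N) (h3 : A3 μ a N) (h4 : A4 μ a N V) :
    (∃ t₁ : ℕ, 1 ≤ t₁ ∧ ∀ t : ℕ, t₁ ≤ t → ∀ η : ℝ, 0 < η → η ≤ 1 →
      ConclA μ a N t (weight V η) ∧ ConclB μ a N t (weight V η) ∧
      ConclC μ a N t (weight V η) ∧ ConclD μ a N t (weight V η)) ∧
    (∀ t : ℕ, 1 ≤ t → ∀ η : ℝ, 0 < η → η < 1 →
      ConclA μ a N t (weight V η) ∧ ConclB μ a N t (weight V η) ∧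
      ConclC μ a N t (weight V η)) := by
  obtain ⟨hC1, K, hK⟩ := h1
  obtain ⟨t₀, -, p, hpC, hp0, hlaw⟩ := h2
  have hM : IsSmoothModel μ a N (max K 0) :=
    ⟨ha, hN, hC1, le_max_right _ _, fun x n => (hK x n).trans (le_max_left _ _)⟩
  have hp : IsC1Density μ a N t₀ p := ⟨hpC, hp0, hlaw⟩
  -- The threshold does not depend on `η`: `t₀` steps are used for the density to be discretized,
  -- and at least `t₀ + 1` more make the weight Feller for the remaining factor.
  refine ⟨⟨2 * t₀ + 1, by omega, fun t ht η h0 h1 => ?_⟩, fun t _ η h0 h1 => ?_⟩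
  · obtain ⟨u, B, hw⟩ := h4.exists_isDriftWeight hM h0 h1
    have hF : IsFellerWeight μ a N t (weight V η) := hw.isFellerWeight hM hp (by omega)
    exact ⟨conclA_of_isFellerWeight hM hw hF, conclB_of_isFellerWeight hM hw hF,
      conclC_of_isFellerWeight hM hw.pos hF, hw.conclD hM hp ht⟩
  · obtain ⟨u, B, hw⟩ := h4.exists_isDriftWeight hM h0 h1.le
    have hF := h4.isFellerWeight_of_lt_one hM h1 t
    exact ⟨conclA_of_isFellerWeight hM hw hF, conclB_of_isFellerWeight hM hw hF,
      conclC_of_isFellerWeight hM hw.pos hF⟩
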